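/- **Conventions.** Let $\mathbb H$ be the real quaternions and $M^*$ the conjugate transpose. $\mathrm{rk}(M)$ is the rank of a quaternion matrix (the dimension of its left row space $\mathcal R_l(M)=\{xM\}$), and $\mathrm{Ind}(M)$ is the smallest positive integer $k$ with $\mathrm{rk}(M^{k+1})=\mathrm{rk}(M^k)$ for square $M$. $M^\dagger$ is the Moore–Penrose inverse. For $M=(m_{ij})\in\mathbb H^{q\times q}$ and an index $j$, the $j$-th column determinant is $$\mathrm{cdet}_j M=\sum_{\tau\in S_q}(-1)^{q-r}\,(m_{j_{k_r}j_{k_r+l_r}}\cdots m_{j_{k_r+1}j_{k_r}})\cdots(m_{j_{k_2}j_{k_2+l_2}}\cdots m_{j_{k_2+1}j_{k_2}})(m_{j\,j_{k_1+l_1}}\cdots m_{j_{k_1+1}j_{k_1}}m_{j_{k_1}j}),$$ where $\tau=(j_{k_r+l_r}\ldots j_{k_r+1}j_{k_r})\cdots(j_{k_2+l_2}\ldots j_{k_2+1}j_{k_2})(j_{k_1+l_1}\ldots j_{k_1+1}j_{k_1}j)$ is written as a product of $r$ disjoint cycles (fixed points included) such that the first cycle from the right starts on the right with $j$, each other cycle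 starts on the right with its minimal element, and these minimal elements increase from right to left. For Hermitian $M$ all $\mathrm{cdet}_jM$ coincide and define $\det M$. $M_{.i}(c)$ is $M$ with its $i$-th column replaced by $c$. $M^\beta_\beta$ is the principal submatrix indexed by $\beta$ (keeping the index labels, so that $\mathrm{cdet}_i M_\beta^\beta$ is taken along the column with label $i\in\beta$), and $|M|^\beta_\beta=\det M^\beta_\beta$ for Hermitian $M$. $J_{s,m}$ is the set of $s$-element subsets of $\{1,\dots,m\}$, and $J_{s,m}\{i\}$ the set of those that contain $i$; when $s=0$, the sums over $J_{s,m}\{i\}$ are empty, hence $0$, and $\sum_{\beta\in J_{0,m}}|M|_\beta^\beta=1$. **Theorem.** Let $A\in\mathbb H^{m\times n}$, $W\in\mathbb H^{n\times m}$, $k=\max\{\mathrm{Ind}(WA),\mathrm{Ind}(AW)\}$, $V=AW\in\mathbb H^{m\times m}$ and $s=\mathrm{rk}(V^k)$. There is a unique matrix $X\in\mathbb H^{m\times n}$ with $$XWAW=[(AW)^k]^\dagger(AW)^k,\qquad \mathcal R_l(X)\subseteq\mathcal R_l\big((WA)^k\big),$$ the left $W$-weighted core-EP inverse $A^{\textcircled{\dagger},W,l}=(a_{ij})$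 of $A$. Put $\widetilde V=(V^{k+1})^*V^kA$ with columns $\widetilde v_{.j}$, define $\Psi=(\psi_{lj})\in\mathbb H^{m\times n}$ by $$\psi_{lj}=\sum_{\beta\in J_{s,m}\{l\}}\mathrm{cdet}_l\Big(\big((V^{k+1})^*V^{k+1}\big)_{.l}(\widetilde v_{.j})\Big)^\beta_\beta ,$$ and let $\widetilde\psi_{.j}$ be the $j$-th column of $\widetilde\Psi=(V^{k+1})^*V^k\Psi$. Then $\sum_{\beta\in J_{s,m}}\big|(V^{k+1})^*V^{k+1}\big|^\beta_\beta\neq0$, and for all $1\le i\le m$, $1\le j\le n$, $$a_{ij}=\frac{\sum_{\beta\in J_{s,m}\{i\}}\mathrm{cdet}_i\Big(\big((V^{k+1})^*V^{k+1}\big)_{.i}(\widetilde\psi_{.j})\Big)^\beta_\beta}{\Big(\sum_{\beta\in J_{s,m}}\big|(V^{k+1})^*V^{k+1}\big|^\beta_\beta\Big)^2}.$$ -/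

import Mathlib

open Quaternion Matrix

noncomputable section

namespace QuatCoreEP

/-! ### Rank and index of quaternion matrices -/

/-- The left row space `R_l(M) = {x M}` of a quaternion matrix, as a left subspace of the space of
row vectors. -/
def rowSpace {m n : Type*} [Fintype m] (M : Matrix m n ℍ[ℝ]) : Submodule ℍ[ℝ] (n → ℍ[ℝ]) :=
  LinearMap.range M.vecMulLinear

/-- The rank of a quaternion matrix: the dimension over `ℍ` of its left row space. -/
def rk {m n : Type*} [Fintype m] (M : Matrix m n ℍ[ℝ]) : ℕ :=
  Module.finrank ℍ[ℝ] (rowSpace M)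

/-- The index of a square quaternion matrix: the smallest positive integer `k` with
`rk (M ^ (k + 1)) = rk (M ^ k)`. -/
def ind {n : Type*} [Fintype n] [DecidableEq n] (M : Matrix n n ℍ[ℝ]) : ℕ :=
  sInf {k : ℕ | 0 < k ∧ rk (M ^ (k + 1)) = rk (M ^ k)}

/-! ### Generalized inverses -/

/-- `Y` is the Moore-Penrose inverse of `B` (the four Penrose equations). -/
structure IsMoorePenrose {m n : Type*} [Fintype m] [Fintype n]
    (B : Matrix m n ℍ[ℝ]) (Y : Matrix n m ℍ[ℝ]) : Prop where
  mul_mul_left : B * Y * B = B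
  mul_mul_right : Y * B * Y = Y
  left_isHermitian : (B * Y)ᴴ = B * Y
  right_isHermitian : (Y * B)ᴴ = Y * B

/-- `X` is a left `W`-weighted core-EP inverse of `A`: with `k = max (Ind (WA)) (Ind (AW))`, one has
`X W A W = ((AW)^k)† (AW)^k` and `R_l(X) ⊆ R_l((WA)^k)`. -/
def IsLeftWeightedCoreEP {m n : ℕ} (A : Matrix (Fin m) (Fin n) ℍ[ℝ])
    (W : Matrix (Fin n) (Fin m) ℍ[ℝ]) (X : Matrix (Fin m) (Fin n) ℍ[ℝ]) : Prop :=
  let k := max (ind (W * A)) (ind (A * W))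
  (∃ Y, IsMoorePenrose ((A * W) ^ k) Y ∧ X * W * A * W = Y * (A * W) ^ k) ∧
    rowSpace X ≤ rowSpace ((W * A) ^ k)

/-! ### Column determinants -/

section Det

variable {ι : Type*} [Fintype ι] [LinearOrder ι]

/-- The ordered product of entries along the cycle of `τ` through `a`, started on the right at `a`:
`M a (τ^(l-1) a) * ⋯ * M (τ^2 a) (τ a) * M (τ a) a`, where `l` is the length of the cycle.
For a fixed point this is `M a a`. -/
def cycleProd (M : Matrix ι ι ℍ[ℝ]) (τ : Equiv.Perm ι) (a : ι) : ℍ[ℝ] :=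
  ((List.range (Function.minimalPeriod τ a)).map
    fun t => M ((τ ^ (t + 1)) a) ((τ ^ t) a)).reverse.prod

/-- The minimal elements of the cycles of `τ` (fixed points included) that do not contain `j`, in
increasing order. -/
def otherStarts (τ : Equiv.Perm ι) (j : ι) : List ι :=
  open scoped Classical in
  (Finset.univ.filter fun a : ι => ¬ τ.SameCycle j a ∧ ∀ b, τ.SameCycle a b → a ≤ b).sort (· ≤ ·)

/-- The `j`-th column determinant. Each permutation is written as a product of disjoint cycles; the
first cycle from the right starts with `j`, the others start from the right with their minimal
elements, and these increase from right to left. The sign `(-1)^(n - r)`, with `r` the number of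
cycles including fixed points, is the sign of the permutation. -/
def cdet (j : ι) (M : Matrix ι ι ℍ[ℝ]) : ℍ[ℝ] :=
  ∑ τ : Equiv.Perm ι,
    Equiv.Perm.sign τ • ((j :: otherStarts τ j).map (cycleProd M τ)).reverse.prod

open scoped Classical in
/-- The determinant of a Hermitian quaternion matrix. All column determinants of a Hermitian matrix
coincide, so it is taken along the first column; the empty determinant is `1`. -/
def hdet (M : Matrix ι ι ℍ[ℝ]) : ℍ[ℝ] :=
  if h : (Finset.univ : Finset ι).Nonempty then cdet (Finset.univ.min' h) M else 1

/-- The principal submatrix of `M` with rows and columns indexed by `β`. -/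
def principal (M : Matrix ι ι ℍ[ℝ]) (β : Finset ι) : Matrix β β ℍ[ℝ] :=
  M.submatrix (fun x => (x : ι)) (fun x => (x : ι))

/-- The sum of the principal minors of order `s` of the Hermitian matrix `M`. -/
def minorSum (s : ℕ) (M : Matrix ι ι ℍ[ℝ]) : ℍ[ℝ] :=
  ∑ β : {β : Finset ι // β.card = s}, hdet (principal M β.1)

/-- The sum, over the index sets `β` of size `s` that contain `i`, of the `i`-th column
determinants of the principal submatrices, indexed by `β`, of the matrix obtained from `M` by
replacing its `i`-th column with `c`. -/
def cdetSum (s : ℕ) (M : Matrix ι ι ℍ[ℝ]) (i : ι) (c : ι → ℍ[ℝ]) : ℍ[ℝ] :=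
  ∑ β : {β : Finset ι // β.card = s ∧ i ∈ β},
    cdet ⟨i, β.2.2⟩ (principal (M.updateCol i c) β.1)

end Det

end QuatCoreEP

end

/-! Two things are needed: a closed form of the inverse, and a Cramer rule over the noncommutative
quaternions. With `V = A * W`, the closed form is `X = (V^(k+1))† V^k (V^(k+1))† V^k A`. It
satisfies the defining equations because `k` is at least the index of `V`, which makes `V^k` a left
multiple of `V^(k+1)`. It is unique because right multiplication by `W * A` is injective on the row
space of `(W * A)^k`.

The Cramer rule rests on averaging. Reversing one cycle of a permutation keeps the sign and, where
the matrix is Hermitian, conjugates the cycle product. Hence every cycle avoiding the distinguished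
index `i` may be replaced by its real part, which is central (`cdet_eq_cycleDet`). What remains is
right linear in column `i`, vanishes when column `i` equals another column
(`cycleDet_eq_zero_of_col_eq`), and for Hermitian matrices is real and independent of `i`.

For Hermitian `H`, let `σ_k` be the sum of principal minors of order `k`, and `R_k` the matrix for
which `cdetSum k H i c` is entry `i` of `R_k c`. Expansion gives `R_k H = σ_k - R_(k+1)`
(`adjugateSum_mul`), so each `R_k` is a real polynomial in `H`. If `K` is the last index with `σ_K ≠
0`, then `R_(K+1) H = 0`, and `σ_K⁻¹ R_K H` is idempotent with the row space of `H`. A trace count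
gives `K = rk H`.

Applied to `H = Bᴴ * B` this yields `B† = σ⁻¹ R Bᴴ`, where `σ = σ_s`, `R = R_s` and `s = rk B`.
Taking `B = V^(k+1)` and substituting twice into the closed form produces the nested column
determinants and the squared denominator. -/

noncomputable section
set_option linter.unusedSectionVars false
namespace QuatCoreEP

/-! ### Products along orbits of a permutation. -/

section Path

variable {ι : Type*}

/-- The ordered product of the entries along the first `n` steps of the orbit of `a` under `τ`. -/
def pathProd (M : Matrix ι ι ℍ[ℝ]) (τ : Equiv.Perm ι) (a : ι) (n : ℕ) : ℍ[ℝ] :=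
  ((List.range n).map fun t => M ((τ ^ (t + 1)) a) ((τ ^ t) a)).reverse.prod

@[simp]
theorem pathProd_zero (M : Matrix ι ι ℍ[ℝ]) (τ : Equiv.Perm ι) (a : ι) : pathProd M τ a 0 = 1 := by
  simp [pathProd]

theorem pathProd_succ (M : Matrix ι ι ℍ[ℝ]) (τ : Equiv.Perm ι) (a : ι) (n : ℕ) :
    pathProd M τ a (n + 1) = M ((τ ^ (n + 1)) a) ((τ ^ n) a) * pathProd M τ a n := by
  simp [pathProd, List.range_succ]

@[simp]
theorem pathProd_one (M : Matrix ι ι ℍ[ℝ]) (τ : Equiv.Perm ι) (a : ι) :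
    pathProd M τ a 1 = M (τ a) a := by
  simp [pathProd]

theorem pathProd_add (M : Matrix ι ι ℍ[ℝ]) (τ : Equiv.Perm ι) (a : ι) (n l : ℕ) :
    pathProd M τ a (n + l) = pathProd M τ ((τ ^ n) a) l * pathProd M τ a n := by
  induction l with
  | zero => simp
  | succ l ih =>
    rw [← add_assoc, pathProd_succ, ih, pathProd_succ, mul_assoc, ← Equiv.Perm.mul_apply,
      ← Equiv.Perm.mul_apply, ← pow_add, ← pow_add]
    congr 4 <;> ring

theorem pathProd_congr {κ : Type*} {M : Matrix ι ι ℍ[ℝ]} {N : Matrix κ κ ℍ[ℝ]}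
    {τ : Equiv.Perm ι} {σ : Equiv.Perm κ} {a : ι} {b : κ} {n : ℕ}
    (h : ∀ t < n, M ((τ ^ (t + 1)) a) ((τ ^ t) a) = N ((σ ^ (t + 1)) b) ((σ ^ t) b)) :
    pathProd M τ a n = pathProd N σ b n := by
  induction n with
  | zero => simp
  | succ n ih =>
    rw [pathProd_succ, pathProd_succ, ih fun t ht => h t (by omega), h n (by omega)]

/-- Conjugation reverses the order of quaternion factors, so a path whose entries are the conjugates
of another's, read backwards, has the conjugate product. -/
theorem star_pathProd (M : Matrix ι ι ℍ[ℝ]) (τ σ : Equiv.Perm ι) (a b : ι) (n : ℕ)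
    (h : ∀ t < n, M ((σ ^ (t + 1)) b) ((σ ^ t) b) =
      star (M ((τ ^ (n - t)) a) ((τ ^ (n - (t + 1))) a))) :
    pathProd M σ b n = star (pathProd M τ a n) := by
  induction n generalizing a b with
  | zero => simp
  | succ n ih =>
    rw [pathProd_succ, h n (by omega), add_comm n 1, pathProd_add M τ, star_mul]
    congr 1
    · simp
    · refine ih _ _ fun t ht => ?_
      rw [h t (by omega), ← Equiv.Perm.mul_apply, ← Equiv.Perm.mul_apply, ← pow_add, ← pow_add]
      congr 4 <;> omega

variable [Finite ι]

theorem minimalPeriod_perm_pos (τ : Equiv.Perm ι) (a : ι) : 0 < Function.minimalPeriod τ a := by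
  refine Function.IsPeriodicPt.minimalPeriod_pos (orderOf_pos τ) ?_
  rw [Function.IsPeriodicPt, Function.IsFixedPt, ← Equiv.Perm.coe_pow, pow_orderOf_eq_one]
  rfl

theorem pow_minimalPeriod_apply (τ : Equiv.Perm ι) (a : ι) :
    (τ ^ Function.minimalPeriod τ a) a = a := by
  rw [Equiv.Perm.coe_pow]
  exact Function.iterate_minimalPeriod

theorem minimalPeriod_eq_of_forall {τ : Equiv.Perm ι} {a : ι} {n : ℕ} (hn : 0 < n)
    (h : (τ ^ n) a = a) (h' : ∀ t, 0 < t → t < n → (τ ^ t) a ≠ a) :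
    Function.minimalPeriod τ a = n := by
  apply le_antisymm
  · refine Function.IsPeriodicPt.minimalPeriod_le hn ?_
    rwa [Function.IsPeriodicPt, Function.IsFixedPt, ← Equiv.Perm.coe_pow]
  · by_contra! hlt
    exact h' _ (minimalPeriod_perm_pos τ a) hlt (pow_minimalPeriod_apply τ a)

theorem pow_apply_ne_of_lt_minimalPeriod {τ : Equiv.Perm ι} {a : ι} {t : ℕ} (ht : 0 < t)
    (h : t < Function.minimalPeriod τ a) : (τ ^ t) a ≠ a := fun hc =>
  absurd (Function.IsPeriodicPt.minimalPeriod_le (f := τ) (x := a) ht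
    (by rwa [Function.IsPeriodicPt, Function.IsFixedPt, ← Equiv.Perm.coe_pow])) (by omega)

end Path

/-! ### Cycle products and their dependence on the starting point. -/

section Cycle

variable {ι : Type*} [Fintype ι] [LinearOrder ι]

theorem cycleProd_eq_pathProd (M : Matrix ι ι ℍ[ℝ]) (τ : Equiv.Perm ι) (a : ι) :
    cycleProd M τ a = pathProd M τ a (Function.minimalPeriod τ a) := rfl

theorem cycleProd_of_fixed (M : Matrix ι ι ℍ[ℝ]) {τ : Equiv.Perm ι} {a : ι} (h : τ a = a) :
    cycleProd M τ a = M a a := by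
  rw [cycleProd_eq_pathProd, Function.minimalPeriod_eq_one_iff_isFixedPt.2 h, pathProd_one, h]

/-- The part of the cycle product left of its rightmost factor. -/
theorem cycleProd_eq_mul (M : Matrix ι ι ℍ[ℝ]) (τ : Equiv.Perm ι) (a : ι) :
    cycleProd M τ a =
      pathProd M τ (τ a) (Function.minimalPeriod τ a - 1) * M (τ a) a := by
  have h := minimalPeriod_perm_pos τ a
  rw [cycleProd_eq_pathProd]
  conv_lhs => rw [show Function.minimalPeriod τ a = 1 + (Function.minimalPeriod τ a - 1) by omega]
  rw [pathProd_add, pathProd_one, pow_one]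

theorem cycleProd_apply_eq_mul (M : Matrix ι ι ℍ[ℝ]) (τ : Equiv.Perm ι) (a : ι) :
    cycleProd M τ (τ a) =
      M (τ a) a * pathProd M τ (τ a) (Function.minimalPeriod τ a - 1) := by
  have h := minimalPeriod_perm_pos τ a
  have hp : Function.minimalPeriod τ (τ a) = Function.minimalPeriod τ a :=
    Function.minimalPeriod_apply (Function.minimalPeriod_pos_iff_mem_periodicPts.1 h)
  rw [cycleProd_eq_pathProd, hp]
  conv_lhs => rw [show Function.minimalPeriod τ a = (Function.minimalPeriod τ a - 1) + 1 by omega]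
  rw [pathProd_succ]
  congr 1
  have e1 : (τ ^ (Function.minimalPeriod τ a - 1)) (τ a) = a := by
    rw [← Equiv.Perm.mul_apply, ← pow_succ, Nat.sub_add_cancel h, pow_minimalPeriod_apply]
  rw [pow_succ', Equiv.Perm.mul_apply, e1]

theorem re_mul_comm (x y : ℍ[ℝ]) : (x * y).re = (y * x).re := by
  simp only [Quaternion.re_mul]; ring

theorem re_cycleProd_apply (M : Matrix ι ι ℍ[ℝ]) (τ : Equiv.Perm ι) (a : ι) :
    (cycleProd M τ (τ a)).re = (cycleProd M τ a).re := by
  rw [cycleProd_apply_eq_mul, cycleProd_eq_mul, re_mul_comm]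

/-- Changing the start rotates the product cyclically, and `Re (x * y) = Re (y * x)`. -/
theorem re_cycleProd_of_sameCycle (M : Matrix ι ι ℍ[ℝ]) {τ : Equiv.Perm ι} {a b : ι}
    (h : τ.SameCycle a b) : (cycleProd M τ a).re = (cycleProd M τ b).re := by
  obtain ⟨n, rfl⟩ := h.exists_nat_pow_eq
  induction n with
  | zero => simp
  | succ n ih =>
    rw [pow_succ', Equiv.Perm.mul_apply, re_cycleProd_apply, ← ih ⟨n, by simp⟩]

/-- Two permutations that agree along the cycle of `a` have the same cycle through `a`. -/
theorem pow_apply_eq_of_agree {τ σ : Equiv.Perm ι} {a : ι}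
    (h : ∀ x, τ.SameCycle a x → σ x = τ x) (n : ℕ) : (σ ^ n) a = (τ ^ n) a := by
  induction n with
  | zero => rfl
  | succ n ih =>
    rw [pow_succ', pow_succ', Equiv.Perm.mul_apply, Equiv.Perm.mul_apply, ih]
    exact h _ ⟨n, by simp⟩

theorem sameCycle_iff_of_agree {τ σ : Equiv.Perm ι} {a : ι}
    (h : ∀ x, τ.SameCycle a x → σ x = τ x) (b : ι) : σ.SameCycle a b ↔ τ.SameCycle a b := by
  constructor <;> intro hs <;> obtain ⟨n, rfl⟩ := hs.exists_nat_pow_eq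
  · exact ⟨n, by simp [pow_apply_eq_of_agree h]⟩
  · exact ⟨n, by simp [pow_apply_eq_of_agree h]⟩

theorem minimalPeriod_eq_of_agree {τ σ : Equiv.Perm ι} {a : ι}
    (h : ∀ x, τ.SameCycle a x → σ x = τ x) :
    Function.minimalPeriod σ a = Function.minimalPeriod τ a := by
  refine Function.minimalPeriod_eq_minimalPeriod_iff.2 fun n => ?_
  rw [Function.IsPeriodicPt, Function.IsFixedPt, Function.IsPeriodicPt, Function.IsFixedPt,
    ← Equiv.Perm.coe_pow, ← Equiv.Perm.coe_pow, pow_apply_eq_of_agree h]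

theorem cycleProd_congr_matrix {M N : Matrix ι ι ℍ[ℝ]} {τ : Equiv.Perm ι} {a : ι}
    (h : ∀ x, τ.SameCycle a x → M (τ x) x = N (τ x) x) : cycleProd M τ a = cycleProd N τ a := by
  refine pathProd_congr fun t _ => ?_
  rw [pow_succ', Equiv.Perm.mul_apply]
  exact h _ ⟨t, by simp⟩

theorem cycleProd_congr_perm (M : Matrix ι ι ℍ[ℝ]) {τ σ : Equiv.Perm ι} {a : ι}
    (h : ∀ x, τ.SameCycle a x → σ x = τ x) : cycleProd M σ a = cycleProd M τ a := by
  rw [cycleProd_eq_pathProd, cycleProd_eq_pathProd, minimalPeriod_eq_of_agree h]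
  exact pathProd_congr fun t _ => by simp only [pow_apply_eq_of_agree h]

end Cycle

/-! ### Reversing one cycle of a permutation. -/

section Reverse

variable {ι : Type*} [Fintype ι] [LinearOrder ι]

open scoped Classical in
/-- The permutation `τ` with the cycle through `u` reversed. -/
def reverseCycle (τ : Equiv.Perm ι) (u : ι) : Equiv.Perm ι :=
  τ * (τ.cycleOf u)⁻¹ ^ 2

/-- The two permutations differ by a square, which is even. -/
theorem sign_reverseCycle (τ : Equiv.Perm ι) (u : ι) :
    Equiv.Perm.sign (reverseCycle τ u) = Equiv.Perm.sign τ := by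
  simp [reverseCycle, Equiv.Perm.sign_mul, Equiv.Perm.sign_inv]

theorem reverseCycle_apply_of_not {τ : Equiv.Perm ι} {u x : ι} (h : ¬ τ.SameCycle u x) :
    reverseCycle τ u x = τ x := by
  classical
  have : (τ.cycleOf u)⁻¹ x = x := by
    rw [Equiv.Perm.inv_eq_iff_eq, Equiv.Perm.cycleOf_apply_of_not_sameCycle h]
  have h2 : ((τ.cycleOf u)⁻¹ ^ 2) x = x := by rw [pow_two, Equiv.Perm.mul_apply, this, this]
  rw [reverseCycle, Equiv.Perm.mul_apply]
  convert congrArg τ h2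

theorem inv_apply_sameCycle {τ : Equiv.Perm ι} {u x : ι} (h : τ.SameCycle u x) :
    τ.SameCycle u (τ⁻¹ x) := by
  rw [← Equiv.Perm.sameCycle_apply_right]
  simpa using h

theorem reverseCycle_apply_of_sameCycle {τ : Equiv.Perm ι} {u x : ι} (h : τ.SameCycle u x) :
    reverseCycle τ u x = τ⁻¹ x := by
  classical
  have key : ∀ y, τ.SameCycle u y → (τ.cycleOf u)⁻¹ y = τ⁻¹ y := fun y hy => by
    rw [Equiv.Perm.cycleOf_inv, Equiv.Perm.SameCycle.cycleOf_apply]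
    rwa [Equiv.Perm.sameCycle_inv]
  have h2 : ((τ.cycleOf u)⁻¹ ^ 2) x = τ⁻¹ (τ⁻¹ x) := by
    rw [pow_two, Equiv.Perm.mul_apply, key x h, key _ (inv_apply_sameCycle h)]
  have h3 : τ (((τ.cycleOf u)⁻¹ ^ 2) x) = τ⁻¹ x := by rw [h2]; simp
  rw [reverseCycle, Equiv.Perm.mul_apply, ← h3]

theorem sameCycle_reverseCycle (τ : Equiv.Perm ι) (u a b : ι) :
    (reverseCycle τ u).SameCycle a b ↔ τ.SameCycle a b := by
  by_cases h : τ.SameCycle u a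
  · rw [sameCycle_iff_of_agree (τ := τ⁻¹), Equiv.Perm.sameCycle_inv]
    intro x hx
    exact reverseCycle_apply_of_sameCycle (h.trans (Equiv.Perm.sameCycle_inv.1 hx))
  · exact sameCycle_iff_of_agree
      (fun x hx => reverseCycle_apply_of_not fun hc => h (hc.trans hx.symm)) b

theorem reverseCycle_reverseCycle (τ : Equiv.Perm ι) (u : ι) :
    reverseCycle (reverseCycle τ u) u = τ := by
  ext x
  by_cases h : τ.SameCycle u x
  · rw [reverseCycle_apply_of_sameCycle ((sameCycle_reverseCycle _ _ _ _).2 h),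
      Equiv.Perm.inv_eq_iff_eq,
      reverseCycle_apply_of_sameCycle (Equiv.Perm.sameCycle_apply_right.2 h)]
    simp
  · rw [reverseCycle_apply_of_not (mt (sameCycle_reverseCycle _ _ _ _).1 h),
      reverseCycle_apply_of_not h]

theorem otherStarts_reverseCycle (τ : Equiv.Perm ι) (u j : ι) :
    otherStarts (reverseCycle τ u) j = otherStarts τ j := by
  simp only [otherStarts, sameCycle_reverseCycle]

theorem cycleProd_reverseCycle_of_not (M : Matrix ι ι ℍ[ℝ]) {τ : Equiv.Perm ι} {u a : ι}
    (h : ¬ τ.SameCycle u a) : cycleProd M (reverseCycle τ u) a = cycleProd M τ a :=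
  cycleProd_congr_perm M fun _ hx => reverseCycle_apply_of_not fun hc => h (hc.trans hx.symm)

theorem cycleProd_reverseCycle_self {M : Matrix ι ι ℍ[ℝ]} {τ : Equiv.Perm ι} {u : ι}
    (hM : ∀ x y, τ.SameCycle u x → τ.SameCycle u y → M x y = star (M y x)) :
    cycleProd M (reverseCycle τ u) u = star (cycleProd M τ u) := by
  rw [cycleProd_congr_perm M (τ := τ⁻¹) fun x hx =>
    reverseCycle_apply_of_sameCycle (Equiv.Perm.sameCycle_inv.1 hx)]
  have hp : Function.minimalPeriod (τ⁻¹ : Equiv.Perm ι) u = Function.minimalPeriod τ u := by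
    refine Function.minimalPeriod_eq_minimalPeriod_iff.2 fun n => ?_
    rw [Function.IsPeriodicPt, Function.IsFixedPt, Function.IsPeriodicPt, Function.IsFixedPt,
      ← Equiv.Perm.coe_pow, ← Equiv.Perm.coe_pow, inv_pow, Equiv.Perm.inv_eq_iff_eq, eq_comm]
  have hq : ∀ t, t ≤ Function.minimalPeriod τ u →
      ((τ⁻¹) ^ t) u = (τ ^ (Function.minimalPeriod τ u - t)) u := fun t ht => by
    rw [inv_pow, Equiv.Perm.inv_eq_iff_eq, ← Equiv.Perm.mul_apply, ← pow_add,
      Nat.add_sub_cancel' ht, pow_minimalPeriod_apply]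
  rw [cycleProd_eq_pathProd, cycleProd_eq_pathProd, hp]
  refine star_pathProd _ _ _ _ _ _ fun t ht => ?_
  rw [hq t (by omega), hq (t + 1) (by omega)]
  exact hM _ _ ⟨_, by rw [zpow_natCast]⟩ ⟨_, by rw [zpow_natCast]⟩

end Reverse

/-! ### Replacing cycle products by their real parts. -/

section Average

variable {ι : Type*} [Fintype ι] [LinearOrder ι]

open scoped Classical in
/-- The minimal elements of the cycles of `τ`, fixed points included. -/
def cycleMins (τ : Equiv.Perm ι) : Finset ι :=
  Finset.univ.filter fun a : ι => ∀ b, τ.SameCycle a b → a ≤ b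

theorem mem_cycleMins {τ : Equiv.Perm ι} {a : ι} :
    a ∈ cycleMins τ ↔ ∀ b, τ.SameCycle a b → a ≤ b := by
  classical simp [cycleMins]

theorem mem_otherStarts {τ : Equiv.Perm ι} {j a : ι} :
    a ∈ otherStarts τ j ↔ ¬ τ.SameCycle j a ∧ ∀ b, τ.SameCycle a b → a ≤ b := by
  classical simp [otherStarts]

theorem nodup_otherStarts (τ : Equiv.Perm ι) (j : ι) : (otherStarts τ j).Nodup := by
  unfold otherStarts
  exact Finset.sort_nodup _ _

theorem nodup_starts (τ : Equiv.Perm ι) (j : ι) : (j :: otherStarts τ j).Nodup :=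
  List.nodup_cons.2 ⟨fun h => (mem_otherStarts.1 h).1 (Equiv.Perm.SameCycle.refl _ _),
    nodup_otherStarts τ j⟩

theorem eq_of_mem_cycleMins {τ : Equiv.Perm ι} {a b : ι} (ha : a ∈ cycleMins τ)
    (hb : b ∈ cycleMins τ) (h : τ.SameCycle a b) : a = b :=
  le_antisymm (mem_cycleMins.1 ha _ h) (mem_cycleMins.1 hb _ h.symm)

theorem eq_of_mem_starts {τ : Equiv.Perm ι} {j a b : ι} (ha : a ∈ j :: otherStarts τ j)
    (hb : b ∈ j :: otherStarts τ j) (h : τ.SameCycle a b) : a = b := by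
  rw [List.mem_cons] at ha hb
  rcases ha with rfl | ha <;> rcases hb with rfl | hb
  · rfl
  · exact absurd h (mem_otherStarts.1 hb).1
  · exact absurd h.symm (mem_otherStarts.1 ha).1
  · exact eq_of_mem_cycleMins (mem_cycleMins.2 (mem_otherStarts.1 ha).2)
      (mem_cycleMins.2 (mem_otherStarts.1 hb).2) h

/-- An ordered product is additive in each factor. As `u` occurs exactly once, averaging that factor
averages the whole product, without any commutativity beyond the centrality of `2`. -/
theorem list_prod_add_list_prod {f g h : ι → ℍ[ℝ]} {u : ι} (l : List ι) (hl : l.Nodup)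
    (hu : u ∈ l) (hf : ∀ a ∈ l, a ≠ u → f a = h a) (hg : ∀ a ∈ l, a ≠ u → g a = h a)
    (hs : f u + g u = 2 * h u) : (l.map f).prod + (l.map g).prod = 2 * (l.map h).prod := by
  induction l with
  | nil => simp at hu
  | cons b l ih =>
    rw [List.nodup_cons] at hl
    simp only [List.map_cons, List.prod_cons]
    by_cases hb : b = u
    · subst hb
      have e : ∀ k : ι → ℍ[ℝ], (∀ a ∈ b :: l, a ≠ b → k a = h a) → l.map k = l.map h := fun k hk =>
        List.map_congr_left fun a ha => hk a (List.mem_cons_of_mem _ ha)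
          fun hc => hl.1 (hc ▸ ha)
      rw [e f hf, e g hg, ← add_mul, hs, mul_assoc]
    · rw [hf b List.mem_cons_self hb, hg b List.mem_cons_self hb, ← mul_add,
        ih hl.2 ((List.mem_cons.1 hu).resolve_left (Ne.symm hb))
          (fun a ha => hf a (List.mem_cons_of_mem _ ha))
          (fun a ha => hg a (List.mem_cons_of_mem _ ha))]
      rw [← mul_assoc, ← mul_assoc, ← Nat.cast_ofNat, (Nat.cast_commute 2 (h b)).eq]

/-- The cycle product, replaced by its real part if its start lies in `S`. -/
def cycleValue (S : Finset ι) (M : Matrix ι ι ℍ[ℝ]) (τ : Equiv.Perm ι) (a : ι) : ℍ[ℝ] :=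
  if a ∈ S then ((cycleProd M τ a).re : ℍ[ℝ]) else cycleProd M τ a

/-- The column determinant with the cycle products started in `S` replaced by their real parts. -/
def partialCdet (S : Finset ι) (j : ι) (M : Matrix ι ι ℍ[ℝ]) : ℍ[ℝ] :=
  ∑ τ : Equiv.Perm ι,
    Equiv.Perm.sign τ • ((j :: otherStarts τ j).map (cycleValue S M τ)).reverse.prod

theorem partialCdet_empty (j : ι) (M : Matrix ι ι ℍ[ℝ]) : partialCdet ∅ j M = cdet j M := by
  have h : ∀ τ, cycleValue ∅ M τ = cycleProd M τ := fun τ => by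
    funext a
    simp [cycleValue]
  simp [partialCdet, cdet, h]

open scoped Classical in
/-- Reversing the cycle through `u` of the permutations satisfying `p`. -/
def reverseIf (p : Equiv.Perm ι → Prop) (u : ι)
    (hp : ∀ τ, p τ → p (reverseCycle τ u)) : Equiv.Perm (Equiv.Perm ι) :=
  Function.Involutive.toPerm (fun τ => if p τ then reverseCycle τ u else τ) fun τ => by
    by_cases h : p τ
    · simp [h, hp τ h, reverseCycle_reverseCycle]
    · simp [h]

theorem reverseIf_of_pos {p : Equiv.Perm ι → Prop} {u : ι}
    (hp : ∀ τ, p τ → p (reverseCycle τ u)) {τ : Equiv.Perm ι} (h : p τ) :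
    reverseIf p u hp τ = reverseCycle τ u :=
  if_pos h

theorem reverseIf_of_neg {p : Equiv.Perm ι → Prop} {u : ι}
    (hp : ∀ τ, p τ → p (reverseCycle τ u)) {τ : Equiv.Perm ι} (h : ¬ p τ) :
    reverseIf p u hp τ = τ :=
  if_neg h

/-- Reversing the cycle started at `u` pairs a cycle product with its conjugate, and their sum is
twice the real part. The involution may have fixed points, so the whole sum is doubled and one copy
reindexed, instead of splitting into orbits. -/
theorem partialCdet_insert {S : Finset ι} {u j : ι} {M : Matrix ι ι ℍ[ℝ]} (hu : u ∉ S)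
    (hM : ∀ τ : Equiv.Perm ι, u ∈ j :: otherStarts τ j →
      ∀ x y, τ.SameCycle u x → τ.SameCycle u y → M x y = star (M y x)) :
    partialCdet (insert u S) j M = partialCdet S j M := by
  have hp : ∀ τ : Equiv.Perm ι, u ∈ j :: otherStarts τ j →
      u ∈ j :: otherStarts (reverseCycle τ u) j := fun τ h => by
    rwa [otherStarts_reverseCycle]
  have h2 : (2 : ℍ[ℝ]) ≠ 0 := by
    have : ((2 : ℝ) : ℍ[ℝ]) ≠ ((0 : ℝ) : ℍ[ℝ]) := Quaternion.coe_injective.ne two_ne_zero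
    exact_mod_cast this
  apply mul_left_cancel₀ h2
  rw [two_mul (partialCdet S j M)]
  conv_rhs =>
    arg 2
    rw [partialCdet, ← Equiv.sum_comp (reverseIf (fun τ => u ∈ j :: otherStarts τ j) u hp)]
  rw [partialCdet, partialCdet, ← Finset.sum_add_distrib, Finset.mul_sum]
  refine Finset.sum_congr rfl fun τ _ => ?_
  by_cases h : u ∈ j :: otherStarts τ j
  · rw [reverseIf_of_pos hp h, sign_reverseCycle, otherStarts_reverseCycle, ← smul_add,
      mul_smul_comm]
    congr 1
    rw [← List.map_reverse, ← List.map_reverse, ← List.map_reverse]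
    symm
    apply list_prod_add_list_prod (u := u) _ (List.nodup_reverse.2 (nodup_starts τ j))
      (List.mem_reverse.2 h)
    · intro a _ ha
      simp [cycleValue, ha]
    · intro a hal ha
      have hn : ¬ τ.SameCycle u a := fun hc =>
        ha (eq_of_mem_starts h (List.mem_reverse.1 hal) hc).symm
      simp [cycleValue, ha, cycleProd_reverseCycle_of_not M hn]
    · simp only [cycleValue, hu, if_false, Finset.mem_insert_self, if_true]
      rw [cycleProd_reverseCycle_self (hM τ h), Quaternion.self_add_star]
  · rw [reverseIf_of_neg hp h, ← two_mul]
    congr 4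
    refine List.map_congr_left fun a ha => ?_
    have : a ≠ u := fun hc => h (hc ▸ ha)
    simp [cycleValue, this]

/-- A matrix that is Hermitian outside of the row and the column of index `i`. -/
def IsHermitianOff (i : ι) (M : Matrix ι ι ℍ[ℝ]) : Prop :=
  ∀ x y, x ≠ i → y ≠ i → M x y = star (M y x)

/-- Cycles started in `S` avoid `j`, hence use only entries where `M` is Hermitian; the starts are
averaged one at a time. -/
theorem partialCdet_eq_cdet {S : Finset ι} {j : ι} {M : Matrix ι ι ℍ[ℝ]} (hj : j ∉ S)
    (hM : IsHermitianOff j M) : partialCdet S j M = cdet j M := by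
  induction S using Finset.induction_on with
  | empty => exact partialCdet_empty j M
  | insert u S hu ih =>
    rw [Finset.mem_insert, not_or] at hj
    rw [partialCdet_insert hu, ih hj.2]
    intro τ hs x y hx hy
    rw [List.mem_cons] at hs
    have hn := (mem_otherStarts.1 (hs.resolve_left (Ne.symm hj.1))).1
    exact hM x y (fun hc => hn (hc ▸ hx.symm)) (fun hc => hn (hc ▸ hy.symm))

theorem partialCdet_univ_eq_cdet {j : ι} {M : Matrix ι ι ℍ[ℝ]} (hM : M.IsHermitian) :
    partialCdet Finset.univ j M = cdet j M := by
  have hM' : ∀ x y, M x y = star (M y x) := fun x y => (hM.apply x y).symm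
  rw [← Finset.insert_erase (Finset.mem_univ j), partialCdet_insert (Finset.notMem_erase _ _),
    partialCdet_eq_cdet (Finset.notMem_erase _ _) fun x y _ _ => hM' x y]
  exact fun τ _ x y _ _ => hM' x y

open scoped Classical in
/-- The column determinant with all cycle products but the first replaced by their real parts. -/
def cycleDet (i : ι) (M : Matrix ι ι ℍ[ℝ]) : ℍ[ℝ] :=
  ∑ τ : Equiv.Perm ι, Equiv.Perm.sign τ •
    ((∏ a ∈ cycleMins τ with ¬ τ.SameCycle i a, (cycleProd M τ a).re) • cycleProd M τ i)

/-- The signed sum over all permutations of the products of the real parts of the cycle products. -/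
def reDet (M : Matrix ι ι ℍ[ℝ]) : ℝ :=
  ∑ τ : Equiv.Perm ι, Equiv.Perm.sign τ • ∏ a ∈ cycleMins τ, (cycleProd M τ a).re

open scoped Classical in
theorem list_prod_otherStarts (f : ι → ℝ) (τ : Equiv.Perm ι) (j : ι) :
    ((otherStarts τ j).map fun a => (f a : ℍ[ℝ])).reverse.prod =
      ((∏ a ∈ cycleMins τ with ¬ τ.SameCycle j a, f a : ℝ) : ℍ[ℝ]) := by
  have h : ∏ a ∈ cycleMins τ with ¬ τ.SameCycle j a, f a = ((otherStarts τ j).map f).prod := by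
    rw [← List.prod_toFinset _ (nodup_otherStarts τ j)]
    refine Finset.prod_congr ?_ fun _ _ => rfl
    ext a
    simp [mem_cycleMins, mem_otherStarts, and_comm]
  rw [h, ← List.prod_reverse ((otherStarts τ j).map f), ← Quaternion.algebraMap_def,
    map_list_prod, List.map_reverse, List.map_map]
  rfl

theorem cdet_eq_cycleDet {i : ι} {M : Matrix ι ι ℍ[ℝ]} (hM : IsHermitianOff i M) :
    cdet i M = cycleDet i M := by
  classical
  rw [← partialCdet_eq_cdet (Finset.notMem_erase i Finset.univ) hM, partialCdet, cycleDet]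
  refine Finset.sum_congr rfl fun τ _ => ?_
  congr 1
  rw [List.map_cons, List.reverse_cons, List.prod_append, List.prod_singleton,
    ← Quaternion.coe_mul_eq_smul]
  congr 1
  · rw [← list_prod_otherStarts]
    congr 2
    refine List.map_congr_left fun a ha => ?_
    have : a ≠ i := fun hc => (mem_otherStarts.1 ha).1 (hc ▸ Equiv.Perm.SameCycle.refl _ _)
    simp [cycleValue, this]
  · simp [cycleValue]

theorem exists_mem_cycleMins (τ : Equiv.Perm ι) (i : ι) :
    ∃ a ∈ cycleMins τ, τ.SameCycle i a := by
  classical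
  obtain ⟨a, ha, hmin⟩ := Finset.exists_min_image (Finset.univ.filter fun a => τ.SameCycle i a) id
    ⟨i, by simp [Equiv.Perm.SameCycle.refl]⟩
  simp only [Finset.mem_filter, Finset.mem_univ, true_and, id] at ha hmin
  exact ⟨a, mem_cycleMins.2 fun b hb => hmin b (ha.trans hb), ha⟩

-- A cycle invariant `f` can be evaluated anywhere on a cycle, so the cycle of `i` splits off as `f
-- i` even when `i` is not its minimum.
open scoped Classical in
theorem prod_cycleMins_eq_mul {τ : Equiv.Perm ι} {f : ι → ℝ}
    (hf : ∀ a b, τ.SameCycle a b → f a = f b) (p : ι → Prop)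
    (hp : ∀ a b, τ.SameCycle a b → (p a ↔ p b)) (i : ι) (hi : p i) :
    ∏ a ∈ cycleMins τ with p a, f a =
      f i * ∏ a ∈ cycleMins τ with p a ∧ ¬ τ.SameCycle i a, f a := by
  obtain ⟨c, hc, hic⟩ := exists_mem_cycleMins τ i
  rw [hf i c hic, ← Finset.prod_insert]
  · refine Finset.prod_congr ?_ fun _ _ => rfl
    ext a
    simp only [Finset.mem_filter, Finset.mem_insert]
    constructor
    · intro h
      by_cases hia : τ.SameCycle i a
      · exact Or.inl (eq_of_mem_cycleMins h.1 hc (hia.symm.trans hic))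
      · exact Or.inr ⟨h.1, h.2, hia⟩
    · rintro (rfl | h)
      · exact ⟨hc, (hp _ _ hic).1 hi⟩
      · exact ⟨h.1, h.2.1⟩
  · simp [hic]

theorem cycleDet_eq_reDet {M : Matrix ι ι ℍ[ℝ]} (hM : M.IsHermitian) (i : ι) :
    cycleDet i M = reDet M := by
  classical
  rw [← cdet_eq_cycleDet fun x y _ _ => (hM.apply x y).symm, ← partialCdet_univ_eq_cdet hM,
    partialCdet, reDet, ← Quaternion.algebraMap_def, map_sum]
  refine Finset.sum_congr rfl fun τ _ => ?_
  have e := prod_cycleMins_eq_mul (τ := τ) (fun _ _ h => re_cycleProd_of_sameCycle M h)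
    (fun _ => True) (fun _ _ _ => Iff.rfl) i trivial
  simp only [Finset.filter_true, true_and] at e
  rw [e, mul_comm, Units.smul_def, Units.smul_def, map_zsmul, map_mul, List.map_cons,
    List.reverse_cons, List.prod_append, List.prod_singleton, Quaternion.algebraMap_def, ← list_prod_otherStarts]
  have hv : cycleValue Finset.univ M τ = fun a => ((cycleProd M τ a).re : ℍ[ℝ]) := by
    funext a
    simp [cycleValue]
  simp [hv]

theorem cdet_eq_reDet {M : Matrix ι ι ℍ[ℝ]} (hM : M.IsHermitian) (i : ι) :
    cdet i M = reDet M := by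
  rw [cdet_eq_cycleDet fun x y _ _ => (hM.apply x y).symm, cycleDet_eq_reDet hM]

theorem hdet_eq_reDet {M : Matrix ι ι ℍ[ℝ]} (hM : M.IsHermitian) : hdet M = reDet M := by
  rw [hdet]
  split_ifs with h
  · exact cdet_eq_reDet hM _
  -- On the empty index type the only permutation contributes an empty product, matching the default
  -- value `1`.
  · rw [Finset.not_nonempty_iff_eq_empty, Finset.univ_eq_empty_iff] at h
    have : cycleMins (1 : Equiv.Perm ι) = ∅ := Finset.eq_empty_of_isEmpty _
    simp [reDet, this]

end Average

/-! ### Merging and splitting cycles by a transposition; equal columns. -/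

section Merge

variable {ι : Type*} [Fintype ι] [LinearOrder ι]

theorem pow_mod_minimalPeriod_apply (τ : Equiv.Perm ι) (a : ι) (n : ℕ) :
    (τ ^ (n % Function.minimalPeriod τ a)) a = (τ ^ n) a := by
  rw [Equiv.Perm.coe_pow, Equiv.Perm.coe_pow, Function.iterate_mod_minimalPeriod_eq]

theorem exists_lt_minimalPeriod {τ : Equiv.Perm ι} {a x : ι} (h : τ.SameCycle a x) :
    ∃ t < Function.minimalPeriod τ a, (τ ^ t) a = x := by
  obtain ⟨n, rfl⟩ := h.exists_nat_pow_eq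
  exact ⟨_, Nat.mod_lt _ (minimalPeriod_perm_pos τ a), pow_mod_minimalPeriod_apply τ a n⟩

theorem cycleProd_eq_zero {M : Matrix ι ι ℍ[ℝ]} {τ : Equiv.Perm ι} {a x : ι}
    (h : τ.SameCycle a x) (hM : M (τ x) x = 0) : cycleProd M τ a = 0 := by
  obtain ⟨t, ht, rfl⟩ := exists_lt_minimalPeriod h
  rw [cycleProd]
  apply List.prod_eq_zero
  rw [List.mem_reverse, List.mem_map]
  refine ⟨t, List.mem_range.2 ht, ?_⟩
  rw [pow_succ', Equiv.Perm.mul_apply, hM]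

theorem sameCycle_pow (τ : Equiv.Perm ι) (a : ι) (n : ℕ) : τ.SameCycle a ((τ ^ n) a) :=
  ⟨n, by simp⟩

/-- After the swap, the orbit of `i` first runs through the whole former cycle of `j`. -/
theorem mul_swap_pow_apply {σ : Equiv.Perm ι} {i j : ι} (h : ¬ σ.SameCycle i j) {t : ℕ}
    (h0 : 0 < t) (ht : t ≤ Function.minimalPeriod σ j) :
    ((σ * Equiv.swap i j) ^ t) i = (σ ^ t) j := by
  induction t, h0 using Nat.le_induction with
  | base => simp
  | succ t h1 ih =>
    rw [pow_succ', pow_succ', Equiv.Perm.mul_apply, Equiv.Perm.mul_apply, ih (by omega),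
      Equiv.Perm.mul_apply, Equiv.swap_apply_of_ne_of_ne]
    · exact fun hc => h (hc ▸ (sameCycle_pow σ j t).symm)
    · exact pow_apply_ne_of_lt_minimalPeriod h1 (by omega)

/-- The merged path leaves from `i` rather than `j`, so only its rightmost factor changes: it is
read in column `i`. Replacing column `j` records this. -/
theorem pathProd_mul_swap (N : Matrix ι ι ℍ[ℝ]) {σ : Equiv.Perm ι} {i j : ι}
    (h : ¬ σ.SameCycle i j) :
    pathProd N (σ * Equiv.swap i j) i (Function.minimalPeriod σ j) =
      cycleProd (N.updateCol j fun a => N a i) σ j := by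
  refine pathProd_congr fun t ht => ?_
  rw [mul_swap_pow_apply h (Nat.succ_pos t) ht]
  rcases Nat.eq_zero_or_pos t with rfl | h0
  · simp
  · rw [mul_swap_pow_apply h h0 ht.le,
      Matrix.updateCol_ne (pow_apply_ne_of_lt_minimalPeriod h0 ht)]

theorem mul_swap_pow_minimalPeriod {σ : Equiv.Perm ι} {i j : ι} (h : ¬ σ.SameCycle i j) :
    ((σ * Equiv.swap i j) ^ Function.minimalPeriod σ j) i = j := by
  rw [mul_swap_pow_apply h (minimalPeriod_perm_pos σ j) le_rfl, pow_minimalPeriod_apply]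

theorem sameCycle_mul_swap {σ : Equiv.Perm ι} {i j : ι} (h : ¬ σ.SameCycle i j) :
    (σ * Equiv.swap i j).SameCycle i j := by
  conv_rhs => rw [← mul_swap_pow_minimalPeriod h]
  exact sameCycle_pow _ _ _

/-- Composing with a transposition merges two cycles. -/
theorem cycleProd_mul_swap (N : Matrix ι ι ℍ[ℝ]) {σ : Equiv.Perm ι} {i j : ι}
    (h : ¬ σ.SameCycle i j) :
    cycleProd N (σ * Equiv.swap i j) i =
      cycleProd (N.updateCol i fun a => N a j) σ i *
        cycleProd (N.updateCol j fun a => N a i) σ j := by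
  have h' : ¬ σ.SameCycle j i := fun hc => h hc.symm
  have hp : Function.minimalPeriod (σ * Equiv.swap i j : Equiv.Perm ι) i =
      Function.minimalPeriod σ j + Function.minimalPeriod σ i := by
    apply minimalPeriod_eq_of_forall
    · have := minimalPeriod_perm_pos σ j; omega
    · rw [add_comm, pow_add, Equiv.Perm.mul_apply, mul_swap_pow_minimalPeriod h, Equiv.swap_comm,
        mul_swap_pow_minimalPeriod h']
    · intro t h0 ht
      rcases le_or_gt t (Function.minimalPeriod σ j) with hle | hlt
      · rw [mul_swap_pow_apply h h0 hle]
        exact fun hc => h (hc ▸ (sameCycle_pow σ j t).symm)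
      · obtain ⟨r, rfl⟩ := Nat.exists_eq_add_of_lt hlt
        rw [show Function.minimalPeriod σ j + r + 1 = (r + 1) + Function.minimalPeriod σ j by ring,
          pow_add, Equiv.Perm.mul_apply, mul_swap_pow_minimalPeriod h, Equiv.swap_comm,
          mul_swap_pow_apply h' (by omega) (by omega)]
        exact pow_apply_ne_of_lt_minimalPeriod (by omega) (by omega)
  rw [cycleProd_eq_pathProd, hp, pathProd_add, pathProd_mul_swap N h,
    mul_swap_pow_minimalPeriod h, Equiv.swap_comm, pathProd_mul_swap N h']

theorem mul_swap_agree {σ : Equiv.Perm ι} {i j a : ι} (hi : ¬ σ.SameCycle i a)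
    (hj : ¬ σ.SameCycle j a) (x : ι) (hx : σ.SameCycle a x) : (σ * Equiv.swap i j) x = σ x := by
  rw [Equiv.Perm.mul_apply, Equiv.swap_apply_of_ne_of_ne]
  · exact fun hc => hi (hc ▸ hx.symm)
  · exact fun hc => hj (hc ▸ hx.symm)

theorem sameCycle_mul_swap_iff {σ : Equiv.Perm ι} {i j : ι} (h : ¬ σ.SameCycle i j) (a : ι) :
    (σ * Equiv.swap i j).SameCycle i a ↔ σ.SameCycle i a ∨ σ.SameCycle j a := by
  have hij := sameCycle_mul_swap h
  constructor
  · intro hs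
    by_contra! hc
    exact hc.1 ((sameCycle_iff_of_agree (mul_swap_agree hc.1 hc.2) i).1 hs.symm).symm
  · have step : ∀ x, (σ * Equiv.swap i j).SameCycle i x →
        (σ * Equiv.swap i j).SameCycle i (σ x) := by
      intro x hx
      by_cases h1 : x = i
      · have : σ x = (σ * Equiv.swap i j) j := by simp [h1]
        rw [this, Equiv.Perm.sameCycle_apply_right]
        exact hij
      by_cases h2 : x = j
      · have : σ x = (σ * Equiv.swap i j) i := by simp [h2]
        rw [this, Equiv.Perm.sameCycle_apply_right]
      · have : σ x = (σ * Equiv.swap i j) x := by simp [Equiv.swap_apply_of_ne_of_ne h1 h2]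
        rwa [this, Equiv.Perm.sameCycle_apply_right]
    have steps : ∀ x, (σ * Equiv.swap i j).SameCycle i x → ∀ n : ℕ,
        (σ * Equiv.swap i j).SameCycle i ((σ ^ n) x) := by
      intro x hx n
      induction n with
      | zero => simpa using hx
      | succ n ih => rw [pow_succ', Equiv.Perm.mul_apply]; exact step _ ih
    rintro (hs | hs) <;> obtain ⟨n, rfl⟩ := hs.exists_nat_pow_eq
    · exact steps i (Equiv.Perm.SameCycle.refl _ _) n
    · exact steps j hij n

open scoped Classical in
theorem prod_cycleMins_mul_swap (M : Matrix ι ι ℍ[ℝ]) {σ : Equiv.Perm ι} {i j : ι}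
    (h : ¬ σ.SameCycle i j) :
    ∏ a ∈ cycleMins (σ * Equiv.swap i j) with ¬ (σ * Equiv.swap i j).SameCycle i a,
        (cycleProd M (σ * Equiv.swap i j) a).re =
      ∏ a ∈ cycleMins σ with ¬ σ.SameCycle i a ∧ ¬ σ.SameCycle j a, (cycleProd M σ a).re := by
  refine Finset.prod_congr ?_ fun a ha => ?_
  · ext a
    simp only [Finset.mem_filter, sameCycle_mul_swap_iff h, not_or]
    refine and_congr_left fun hc => ?_
    simp only [mem_cycleMins, sameCycle_iff_of_agree (mul_swap_agree hc.1 hc.2)]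
  · rw [Finset.mem_filter] at ha
    rw [cycleProd_congr_perm M (mul_swap_agree ha.2.1 ha.2.2)]

theorem not_sameCycle_mul_swap {τ : Equiv.Perm ι} {i j : ι} (hne : i ≠ j)
    (h : τ.SameCycle i j) : ¬ (τ * Equiv.swap i j).SameCycle i j := by
  classical
  have hex : ∃ n : ℕ, (τ ^ n) i = j := h.exists_nat_pow_eq
  -- With `p` the first time the orbit of `i` meets `j`, the new cycle of `j` is `τ i, …, τ^p i =
  -- j`, which misses `i`.
  obtain ⟨p, hp, hmin⟩ : ∃ p : ℕ, (τ ^ p) i = j ∧ ∀ t < p, (τ ^ t) i ≠ j :=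
    ⟨Nat.find hex, Nat.find_spec hex, fun t ht => Nat.find_min hex ht⟩
  have h0 : 0 < p := by
    rcases Nat.eq_zero_or_pos p with rfl | h0
    · exact absurd hp hne
    · exact h0
  have hi : ∀ t, 0 < t → t < p → (τ ^ t) i ≠ i := fun t ht htp hc => by
    refine hmin (p - t) (by omega) ?_
    rw [← hp]
    conv_rhs => rw [← Nat.sub_add_cancel htp.le, pow_add, Equiv.Perm.mul_apply, hc]
  have key : ∀ t, 0 < t → t ≤ p → ((τ * Equiv.swap i j) ^ t) j = (τ ^ t) i := by
    intro t ht htp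
    induction t, ht using Nat.le_induction with
    | base => simp
    | succ t h1 ih =>
      rw [pow_succ', pow_succ', Equiv.Perm.mul_apply, Equiv.Perm.mul_apply, ih (by omega),
        Equiv.Perm.mul_apply, Equiv.swap_apply_of_ne_of_ne (hi t h1 (by omega))
          (hmin t (by omega))]
  intro hc
  obtain ⟨t, ht, hti⟩ := exists_lt_minimalPeriod hc.symm
  have hle : Function.minimalPeriod (τ * Equiv.swap i j : Equiv.Perm ι) j ≤ p := by
    by_contra! hlt
    exact pow_apply_ne_of_lt_minimalPeriod h0 hlt ((key p h0 le_rfl).trans hp)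
  rcases Nat.eq_zero_or_pos t with rfl | ht0
  · exact hne hti.symm
  · rw [key t ht0 (by omega)] at hti
    exact hi t ht0 (by omega) hti

open scoped Classical in
theorem prod_cycleMins_not_sameCycle {σ : Equiv.Perm ι} {f : ι → ℝ}
    (hf : ∀ a b, σ.SameCycle a b → f a = f b) {i j : ι} (h : ¬ σ.SameCycle i j) :
    ∏ a ∈ cycleMins σ with ¬ σ.SameCycle i a, f a =
      f j * ∏ a ∈ cycleMins σ with ¬ σ.SameCycle i a ∧ ¬ σ.SameCycle j a, f a := by
  convert prod_cycleMins_eq_mul hf (fun a => ¬ σ.SameCycle i a)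
    (fun a b hab => not_congr ⟨fun h => h.trans hab, fun h => h.trans hab.symm⟩) j h

theorem quaternion_eq_zero_of_eq_neg {x : ℍ[ℝ]} (h : x = -x) : x = 0 := by
  have h2 : (2 : ℝ) • x = 0 := by
    rw [two_smul]
    nth_rewrite 2 [h]
    simp
  exact (smul_eq_zero.1 h2).resolve_left two_ne_zero

-- Composition with the transposition matches permutations joining `i` and `j` with those separating
-- them, with opposite sign. For equal columns the merged product is `C_i * C_j`, so each pair
-- contributes a real multiple of `C_i * (Re C_j - C_j)`. Reversing the cycle of `j`, which avoids
-- `i`, conjugates `C_j` and negates this, so the total equals its own negative.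
open scoped Classical in
theorem cycleDet_eq_zero_of_col_eq {M : Matrix ι ι ℍ[ℝ]} {i j : ι} (hne : i ≠ j)
    (hM : IsHermitianOff i M) (hcol : ∀ a, M a i = M a j) : cycleDet i M = 0 := by
  set P : Equiv.Perm ι → ℝ := fun σ =>
    ∏ a ∈ cycleMins σ with ¬ σ.SameCycle i a ∧ ¬ σ.SameCycle j a, (cycleProd M σ a).re with hP
  set U : Equiv.Perm ι → ℍ[ℝ] := fun σ => if σ.SameCycle i j then 0 else
    Equiv.Perm.sign σ • (P σ • (cycleProd M σ i *
      (((cycleProd M σ j).re : ℍ[ℝ]) - cycleProd M σ j))) with hU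
  have hsum : cycleDet i M = ∑ σ, U σ := by
    rw [cycleDet, ← Finset.sum_filter_add_sum_filter_not _ (fun τ => τ.SameCycle i j)]
    have e1 : ∑ τ with τ.SameCycle i j, Equiv.Perm.sign τ •
        ((∏ a ∈ cycleMins τ with ¬ τ.SameCycle i a, (cycleProd M τ a).re) • cycleProd M τ i) =
        ∑ σ : Equiv.Perm ι with ¬ σ.SameCycle i j,
          -(Equiv.Perm.sign σ • (P σ • (cycleProd M σ i * cycleProd M σ j))) := by
      refine Finset.sum_nbij' (· * Equiv.swap i j) (· * Equiv.swap i j) ?_ ?_ ?_ ?_ ?_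
      · intro τ hτ
        simpa using not_sameCycle_mul_swap hne (by simpa using hτ)
      · intro τ hτ
        simpa using sameCycle_mul_swap (by simpa using hτ)
      · intro τ _; simp [mul_assoc]
      · intro τ _; simp [mul_assoc]
      · intro τ hτ
        have hn := not_sameCycle_mul_swap hne (by simpa using hτ)
        set σ := τ * Equiv.swap i j with hσ
        have hτσ : τ = σ * Equiv.swap i j := by simp [hσ, mul_assoc]
        have e1 : (M.updateCol i fun a => M a j) = M := by
          simp only [← hcol]; exact Matrix.updateCol_eq_self M i
        have e2 : (M.updateCol j fun a => M a i) = M := by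
          simp only [hcol]; exact Matrix.updateCol_eq_self M j
        rw [hτσ, prod_cycleMins_mul_swap M hn, cycleProd_mul_swap M hn, e1, e2,
          Equiv.Perm.sign_mul, Equiv.Perm.sign_swap hne]
        simp [hP]
    rw [e1, ← Finset.sum_add_distrib, Finset.sum_filter]
    refine Finset.sum_congr rfl fun σ _ => ?_
    by_cases hs : σ.SameCycle i j
    · simp [hU, hs]
    · simp only [hs, not_false_eq_true, if_true, hU, if_false]
      rw [prod_cycleMins_not_sameCycle (fun _ _ h => re_cycleProd_of_sameCycle M h) hs,
        mul_sub, smul_sub, smul_sub,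
        ← show P σ = ∏ a ∈ cycleMins σ with ¬ σ.SameCycle i a ∧ ¬ σ.SameCycle j a,
          (cycleProd M σ a).re from rfl, mul_comm, mul_smul, Quaternion.mul_coe_eq_smul]
      abel
  rw [hsum]
  apply quaternion_eq_zero_of_eq_neg
  have hp : ∀ τ : Equiv.Perm ι, ¬ τ.SameCycle i j → ¬ (reverseCycle τ j).SameCycle i j := by
    intro τ h
    rwa [sameCycle_reverseCycle]
  conv_lhs => rw [← Equiv.sum_comp (reverseIf (fun τ => ¬ τ.SameCycle i j) j hp)]
  rw [← Finset.sum_neg_distrib]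
  refine Finset.sum_congr rfl fun σ _ => ?_
  by_cases hs : σ.SameCycle i j
  · rw [reverseIf_of_neg hp (not_not.2 hs)]
    simp [hU, hs]
  · rw [reverseIf_of_pos hp hs]
    have hs' : ¬ σ.SameCycle j i := fun h => hs h.symm
    have hPr : P (reverseCycle σ j) = P σ := by
      simp only [hP]
      refine Finset.prod_congr ?_ fun a ha => ?_
      · ext a
        simp [mem_cycleMins, sameCycle_reverseCycle]
      · rw [Finset.mem_filter] at ha
        rw [cycleProd_reverseCycle_of_not M ha.2.2]
    have hstar : cycleProd M (reverseCycle σ j) j = star (cycleProd M σ j) :=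
      cycleProd_reverseCycle_self fun x y hx hy =>
        hM x y (fun hc => hs' (hc ▸ hx)) (fun hc => hs' (hc ▸ hy))
    simp only [hU, hs, sameCycle_reverseCycle, if_false, sign_reverseCycle, hPr, hstar,
      cycleProd_reverseCycle_of_not M hs', Quaternion.re_star]
    rw [← smul_neg, ← smul_neg, ← mul_neg, Quaternion.star_eq_two_re_sub]
    congr 3
    rw [two_mul, Quaternion.coe_add]
    abel

end Merge

/-! ### Linearity in the distinguished column, and unit columns. -/

section Linear

variable {ι : Type*} [Fintype ι] [LinearOrder ι]

open scoped Classical in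
/-- The contribution of the permutation `τ` to `cycleDet`. -/
def cycleTerm (i : ι) (M : Matrix ι ι ℍ[ℝ]) (τ : Equiv.Perm ι) : ℍ[ℝ] :=
  (∏ a ∈ cycleMins τ with ¬ τ.SameCycle i a, (cycleProd M τ a).re) • cycleProd M τ i

theorem cycleDet_eq_sum (i : ι) (M : Matrix ι ι ℍ[ℝ]) :
    cycleDet i M = ∑ τ : Equiv.Perm ι, Equiv.Perm.sign τ • cycleTerm i M τ := rfl

theorem prod_cycleMins_eq_zero {M : Matrix ι ι ℍ[ℝ]} {τ : Equiv.Perm ι} {x : ι}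
    (h : M (τ x) x = 0) : ∏ a ∈ cycleMins τ, (cycleProd M τ a).re = 0 := by
  obtain ⟨c, hc, hxc⟩ := exists_mem_cycleMins τ x
  refine Finset.prod_eq_zero hc ?_
  rw [cycleProd_eq_zero hxc.symm h, Quaternion.re_zero]

theorem cycleTerm_eq_zero {i : ι} {M : Matrix ι ι ℍ[ℝ]} {τ : Equiv.Perm ι} {x : ι}
    (h : M (τ x) x = 0) : cycleTerm i M τ = 0 := by
  classical
  rw [cycleTerm]
  by_cases hi : τ.SameCycle i x
  · rw [cycleProd_eq_zero hi h, smul_zero]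
  · obtain ⟨c, hc, hxc⟩ := exists_mem_cycleMins τ x
    rw [Finset.prod_eq_zero (i := c), zero_smul]
    · exact Finset.mem_filter.2 ⟨hc, fun hic => hi (hic.trans hxc.symm)⟩
    · rw [cycleProd_eq_zero hxc.symm h, Quaternion.re_zero]

open scoped Classical in
/-- The factor of `cycleTerm` left of the entry from the column of index `i`. -/
def cycleCofactor (i : ι) (M : Matrix ι ι ℍ[ℝ]) (τ : Equiv.Perm ι) : ℍ[ℝ] :=
  (∏ a ∈ cycleMins τ with ¬ τ.SameCycle i a, (cycleProd M τ a).re) •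
    pathProd M τ (τ i) (Function.minimalPeriod τ i - 1)

theorem cycleTerm_eq_mul (i : ι) (M : Matrix ι ι ℍ[ℝ]) (τ : Equiv.Perm ι) :
    cycleTerm i M τ = cycleCofactor i M τ * M (τ i) i := by
  rw [cycleTerm, cycleCofactor, cycleProd_eq_mul, smul_mul_assoc]

/-- Column `i` is read only once, by the rightmost factor of the cycle through `i`; the cofactor
omits that factor. -/
theorem cycleCofactor_updateCol (i : ι) (M : Matrix ι ι ℍ[ℝ]) (c : ι → ℍ[ℝ]) (τ : Equiv.Perm ι) :
    cycleCofactor i (M.updateCol i c) τ = cycleCofactor i M τ := by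
  classical
  rw [cycleCofactor, cycleCofactor]
  congr 1
  · refine Finset.prod_congr rfl fun a ha => ?_
    rw [cycleProd_congr_matrix fun x hx => ?_]
    rw [Matrix.updateCol_ne]
    exact fun hc => (Finset.mem_filter.1 ha).2 (hc ▸ hx.symm)
  · refine pathProd_congr fun t ht => ?_
    rw [Matrix.updateCol_ne]
    rw [← Equiv.Perm.mul_apply, ← pow_succ]
    exact pow_apply_ne_of_lt_minimalPeriod (by omega) (by omega)

theorem cycleDet_updateCol (i : ι) (M : Matrix ι ι ℍ[ℝ]) (c : ι → ℍ[ℝ]) :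
    cycleDet i (M.updateCol i c) =
      ∑ τ : Equiv.Perm ι, Equiv.Perm.sign τ • (cycleCofactor i M τ * c (τ i)) := by
  simp only [cycleDet_eq_sum, cycleTerm_eq_mul, cycleCofactor_updateCol, Matrix.updateCol_self]

theorem cycleDet_updateCol_zero (i : ι) (M : Matrix ι ι ℍ[ℝ]) :
    cycleDet i (M.updateCol i 0) = 0 := by
  simp [cycleDet_updateCol]

theorem cycleDet_updateCol_eq_sum (i : ι) (M : Matrix ι ι ℍ[ℝ]) (c : ι → ℍ[ℝ]) :
    cycleDet i (M.updateCol i c) =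
      ∑ t, cycleDet i (M.updateCol i (Pi.single t 1)) * c t := by
  simp only [cycleDet_updateCol, Finset.sum_mul]
  rw [Finset.sum_comm]
  refine Finset.sum_congr rfl fun τ _ => ?_
  rw [Finset.sum_eq_single (τ i)]
  · simp [smul_mul_assoc]
  · intro t _ ht
    simp [Ne.symm ht]
  · simp

/-- Only permutations fixing `i` survive, so the rest of row `i` is never read. -/
theorem cycleDet_congr_of_single {i : ι} {M N : Matrix ι ι ℍ[ℝ]}
    (hM : ∀ a, M a i = if a = i then 1 else 0) (hN : ∀ a, N a i = if a = i then 1 else 0)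
    (h : ∀ a b, a ≠ i → b ≠ i → M a b = N a b) : cycleDet i M = cycleDet i N := by
  classical
  rw [cycleDet_eq_sum, cycleDet_eq_sum]
  refine Finset.sum_congr rfl fun τ _ => ?_
  congr 1
  by_cases hτ : τ i = i
  · rw [cycleTerm, cycleTerm, cycleProd_of_fixed _ hτ, cycleProd_of_fixed _ hτ, hM, hN]
    congr 1
    refine Finset.prod_congr rfl fun a ha => ?_
    have hia := (Finset.mem_filter.1 ha).2
    rw [cycleProd_congr_matrix fun x hx => ?_]
    refine h _ _ (fun hc => ?_) (fun hc => hia (hc ▸ hx.symm))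
    exact hia (hc ▸ (Equiv.Perm.sameCycle_apply_right.2 hx).symm)
  · rw [cycleTerm_eq_zero (x := i), cycleTerm_eq_zero (x := i)]
    · rw [hN, if_neg hτ]
    · rw [hM, if_neg hτ]

/-- On the left only permutations sending `i` to `j` survive, on the right only those fixing `j`.
The transposition of `i` and `j` matches them and supplies the sign; row `j` outside the unit
columns plays no role. -/
theorem cycleDet_eq_neg_of_single {i j : ι} (hne : i ≠ j) {M N : Matrix ι ι ℍ[ℝ]}
    (hM : ∀ a, M a i = if a = j then 1 else 0) (hN : ∀ a, N a j = if a = j then 1 else 0)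
    (hi : ∀ a, a ≠ j → M a j = N a i)
    (h : ∀ a b, a ≠ j → b ≠ i → b ≠ j → M a b = N a b) : cycleDet i M = -cycleDet i N := by
  classical
  rw [cycleDet_eq_sum, cycleDet_eq_sum, ← Equiv.sum_comp (Equiv.mulRight (Equiv.swap i j)),
    ← Finset.sum_neg_distrib]
  refine Finset.sum_congr rfl fun σ _ => ?_
  rw [Equiv.coe_mulRight, Equiv.Perm.sign_mul, Equiv.Perm.sign_swap hne, mul_neg_one,
    Units.neg_smul]
  congr 2
  by_cases hσ : σ j = j
  · have hs : ¬ σ.SameCycle i j := fun hc => hne (hc.eq_of_right hσ)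
    have hj : ∀ x, σ.SameCycle i x → x ≠ j := fun x hx hc => hs (hc ▸ hx)
    rw [cycleTerm, cycleTerm, prod_cycleMins_mul_swap M hs, cycleProd_mul_swap M hs,
      cycleProd_of_fixed _ hσ, Matrix.updateCol_self, hM, if_pos rfl, mul_one,
      prod_cycleMins_not_sameCycle (fun _ _ h => re_cycleProd_of_sameCycle N h) hs,
      cycleProd_of_fixed _ hσ, hN, if_pos rfl, Quaternion.re_one, one_mul]
    congr 1
    · refine Finset.prod_congr rfl fun a ha => ?_
      obtain ⟨-, hia, hja⟩ := Finset.mem_filter.1 ha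
      rw [cycleProd_congr_matrix fun x hx => ?_]
      refine h _ _ (fun hc => hja ?_) (fun hc => hia (hc ▸ hx.symm)) (fun hc => hja (hc ▸ hx.symm))
      exact hc ▸ (Equiv.Perm.sameCycle_apply_right.2 hx).symm
    · refine cycleProd_congr_matrix fun x hx => ?_
      have h1 := hj _ hx
      have h2 := hj _ (Equiv.Perm.sameCycle_apply_right.2 hx)
      by_cases hxi : x = i
      · subst hxi
        rw [Matrix.updateCol_self, hi _ h2]
      · rw [Matrix.updateCol_ne hxi, h _ _ h2 hxi h1]
  · rw [cycleTerm_eq_zero (x := i), cycleTerm_eq_zero (x := j)]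
    · rw [hN, if_neg hσ]
    · rw [hM, if_neg]
      simpa using hσ

end Linear

/-! ### Principal submatrices padded by the identity. -/

section Pad

variable {ι : Type*} [Fintype ι] [LinearOrder ι]

/-- The matrix `M` on the rows and columns indexed by `β`, and the identity matrix elsewhere. -/
def padOne (β : Finset ι) (M : Matrix ι ι ℍ[ℝ]) : Matrix ι ι ℍ[ℝ] :=
  Matrix.of fun a b => if a ∈ β ∧ b ∈ β then M a b else if a = b then 1 else 0

theorem padOne_apply (β : Finset ι) (M : Matrix ι ι ℍ[ℝ]) (a b : ι) :
    padOne β M a b = if a ∈ β ∧ b ∈ β then M a b else if a = b then 1 else 0 := rfl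

theorem ofSubtype_pow_apply_coe {β : Finset ι} (σ : Equiv.Perm β) (n : ℕ) (a : β) :
    ((Equiv.Perm.ofSubtype σ) ^ n) (a : ι) = ((σ ^ n) a : β) := by
  rw [← map_pow, Equiv.Perm.ofSubtype_apply_coe]

theorem sameCycle_ofSubtype {β : Finset ι} (σ : Equiv.Perm β) (a b : β) :
    (Equiv.Perm.ofSubtype σ).SameCycle (a : ι) b ↔ σ.SameCycle a b := by
  constructor <;> intro h <;> obtain ⟨n, hn⟩ := h.exists_nat_pow_eq
  · rw [ofSubtype_pow_apply_coe, Subtype.coe_inj] at hn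
    exact ⟨n, by simpa using hn⟩
  · refine ⟨n, ?_⟩
    rw [zpow_natCast, ofSubtype_pow_apply_coe, hn]

theorem cycleProd_padOne_ofSubtype {β : Finset ι} (M : Matrix ι ι ℍ[ℝ]) (σ : Equiv.Perm β)
    (a : β) : cycleProd (padOne β M) (Equiv.Perm.ofSubtype σ) a = cycleProd (principal M β) σ a := by
  have hp : Function.minimalPeriod (Equiv.Perm.ofSubtype σ) (a : ι) =
      Function.minimalPeriod σ a := by
    refine Function.minimalPeriod_eq_minimalPeriod_iff.2 fun n => ?_
    rw [Function.IsPeriodicPt, Function.IsFixedPt, Function.IsPeriodicPt, Function.IsFixedPt,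
      ← Equiv.Perm.coe_pow, ← Equiv.Perm.coe_pow, ofSubtype_pow_apply_coe, Subtype.coe_inj]
  rw [cycleProd_eq_pathProd, hp]
  refine pathProd_congr fun t _ => ?_
  rw [ofSubtype_pow_apply_coe, ofSubtype_pow_apply_coe, padOne_apply,
    if_pos ⟨Subtype.coe_prop _, Subtype.coe_prop _⟩]
  rfl

open scoped Classical in
theorem prod_cycleMins_ofSubtype {β : Finset ι} (M : Matrix ι ι ℍ[ℝ]) (σ : Equiv.Perm β)
    (p : ι → Prop) :
    ∏ a ∈ (cycleMins σ).filter fun a : β => p a, (cycleProd (principal M β) σ a).re =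
      ∏ a ∈ cycleMins (Equiv.Perm.ofSubtype σ) with p a,
        (cycleProd (padOne β M) (Equiv.Perm.ofSubtype σ) a).re := by
  have hmem : ∀ a : β, (a : ι) ∈ cycleMins (Equiv.Perm.ofSubtype σ) ↔ a ∈ cycleMins σ := by
    intro a
    rw [mem_cycleMins, mem_cycleMins]
    constructor
    · exact fun h b hb => h b ((sameCycle_ofSubtype σ a b).2 hb)
    · intro h b hb
      have hbβ : b ∈ β := by
        obtain ⟨n, rfl⟩ := hb.exists_nat_pow_eq
        rw [ofSubtype_pow_apply_coe]
        exact Subtype.coe_prop _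
      exact h ⟨b, hbβ⟩ ((sameCycle_ofSubtype σ a ⟨b, hbβ⟩).1 hb)
  refine Finset.prod_of_injOn Subtype.val Subtype.val_injective.injOn ?_ ?_ ?_
  · intro a ha
    simp only [Finset.coe_filter, Set.mem_ofPred_eq] at ha ⊢
    exact ⟨(hmem a).2 ha.1, ha.2⟩
  · intro a ha hna
    have hβ : a ∉ β := fun hc => hna ⟨⟨a, hc⟩, by
      rw [Finset.mem_filter] at ha
      simp only [Finset.coe_filter, Set.mem_ofPred_eq]
      exact ⟨(hmem ⟨a, hc⟩).1 ha.1, ha.2⟩, rfl⟩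
    rw [cycleProd_of_fixed _ (Equiv.Perm.ofSubtype_apply_of_not_mem σ hβ), padOne_apply]
    simp [hβ]
  · intro a _
    rw [cycleProd_padOne_ofSubtype]

/-- A permutation that does not come from `β` moves some index outside `β`, where it meets an
off-diagonal zero. -/
theorem exists_padOne_eq_zero {β : Finset ι} (M : Matrix ι ι ℍ[ℝ]) {τ : Equiv.Perm ι}
    (h : ∀ σ : Equiv.Perm β, Equiv.Perm.ofSubtype σ ≠ τ) : ∃ x, padOne β M (τ x) x = 0 := by
  by_contra! hc
  have hfix : ∀ x, x ∉ β → τ x = x := by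
    intro x hx
    by_contra hne
    exact hc x (by simp [padOne_apply, hx, hne])
  have h1 : ∀ x, τ x ∈ β ↔ x ∈ β := fun x => by
    constructor
    · intro hx
      by_contra hn
      exact hn (hfix x hn ▸ hx)
    · intro hx
      by_contra hn
      exact hn ((τ.injective (hfix _ hn)).symm ▸ hx)
  exact h _ (Equiv.Perm.ofSubtype_subtypePerm h1 fun x hx => by
    by_contra hn
    exact hx (hfix x hn))

/-- Padding puts minors of all orders on the same index type, where different `β` can be compared.
-/
theorem cycleDet_principal {β : Finset ι} (M : Matrix ι ι ℍ[ℝ]) (i : β) :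
    cycleDet i (principal M β) = cycleDet (i : ι) (padOne β M) := by
  classical
  rw [cycleDet_eq_sum, cycleDet_eq_sum]
  refine Finset.sum_of_injOn (fun σ => Equiv.Perm.ofSubtype σ)
    Equiv.Perm.ofSubtype_injective.injOn (fun _ _ => Finset.mem_coe.2 (Finset.mem_univ _)) ?_ ?_
  · intro τ _ hτ
    obtain ⟨x, hx⟩ := exists_padOne_eq_zero M (τ := τ) fun σ hσ => hτ ⟨σ, by simp, hσ⟩
    rw [cycleTerm_eq_zero hx, smul_zero]
  · intro σ _
    have h := prod_cycleMins_ofSubtype M σ fun a => ¬ (Equiv.Perm.ofSubtype σ).SameCycle (i : ι) a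
    simp only [sameCycle_ofSubtype] at h
    have e : cycleTerm i (principal M β) σ =
        cycleTerm (i : ι) (padOne β M) (Equiv.Perm.ofSubtype σ) := by
      rw [cycleTerm, cycleTerm, cycleProd_padOne_ofSubtype]
      congr 1
      convert h
    rw [e]
    congr 1
    convert (Equiv.Perm.sign_ofSubtype σ).symm

theorem reDet_principal {β : Finset ι} (M : Matrix ι ι ℍ[ℝ]) :
    reDet (principal M β) = reDet (padOne β M) := by
  classical
  rw [reDet, reDet]
  refine Finset.sum_of_injOn (fun σ => Equiv.Perm.ofSubtype σ)
    Equiv.Perm.ofSubtype_injective.injOn (fun _ _ => Finset.mem_coe.2 (Finset.mem_univ _)) ?_ ?_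
  · intro τ _ hτ
    obtain ⟨x, hx⟩ := exists_padOne_eq_zero M (τ := τ) fun σ hσ => hτ ⟨σ, by simp, hσ⟩
    rw [prod_cycleMins_eq_zero hx, smul_zero]
  · intro σ _
    have h := prod_cycleMins_ofSubtype M σ fun _ => True
    simp only [Finset.filter_true] at h
    rw [h]
    congr 1
    convert (Equiv.Perm.sign_ofSubtype σ).symm

end Pad

/-! ### Sums of minors and the Faddeev–LeVerrier recursion. -/

section Adjugate

variable {ι : Type*} [Fintype ι] [LinearOrder ι]

theorem isHermitian_padOne {H : Matrix ι ι ℍ[ℝ]} (hH : H.IsHermitian) (β : Finset ι) :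
    (padOne β H).IsHermitian := by
  refine Matrix.IsHermitian.ext fun a b => ?_
  rw [padOne_apply, padOne_apply]
  by_cases ha : a ∈ β <;> by_cases hb : b ∈ β <;> by_cases hab : a = b <;>
    simp [ha, hb, hab, hH.apply, Ne.symm]

theorem isHermitian_principal {H : Matrix ι ι ℍ[ℝ]} (hH : H.IsHermitian) (β : Finset ι) :
    (principal H β).IsHermitian :=
  hH.submatrix _

theorem padOne_updateCol (H : Matrix ι ι ℍ[ℝ]) (c : ι → ℍ[ℝ]) {β : Finset ι} {i : ι}
    (hi : i ∈ β) : padOne β (H.updateCol i c) =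
      (padOne β H).updateCol i fun a => if a ∈ β then c a else 0 := by
  ext1 a b
  rw [padOne_apply]
  by_cases hb : b = i
  · subst hb
    simp only [hi, and_true, Matrix.updateCol_self]
    by_cases ha : a ∈ β
    · simp [ha]
    · have : a ≠ b := fun hc => ha (hc ▸ hi)
      simp [ha, this]
  · rw [Matrix.updateCol_ne hb, Matrix.updateCol_ne hb, padOne_apply]

theorem isHermitianOff_padOne_updateCol {H : Matrix ι ι ℍ[ℝ]} (hH : H.IsHermitian)
    (c : ι → ℍ[ℝ]) {β : Finset ι} {i : ι} (hi : i ∈ β) :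
    IsHermitianOff i (padOne β (H.updateCol i c)) := by
  intro x y hx hy
  rw [padOne_updateCol H c hi, Matrix.updateCol_ne hx, Matrix.updateCol_ne hy,
    (isHermitian_padOne hH β).apply]

theorem cdetSum_eq_sum_powersetCard {H : Matrix ι ι ℍ[ℝ]} (hH : H.IsHermitian) (k : ℕ) (i : ι)
    (c : ι → ℍ[ℝ]) : cdetSum k H i c =
      ∑ β ∈ (Finset.univ.powersetCard k).filter (i ∈ ·),
        cycleDet i (padOne β (H.updateCol i c)) := by
  rw [cdetSum, Finset.sum_subtype _ (p := fun β : Finset ι => β.card = k ∧ i ∈ β) (by simp)]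
  refine Finset.sum_congr rfl fun β _ => ?_
  rw [cdet_eq_cycleDet, cycleDet_principal]
  intro x y hx hy
  have hx' : (x : ι) ≠ i := fun hc => hx (Subtype.ext hc)
  have hy' : (y : ι) ≠ i := fun hc => hy (Subtype.ext hc)
  simp [principal, Matrix.updateCol_ne hx', Matrix.updateCol_ne hy', hH.apply]

/-- The sum of the principal minors of order `k`, as a real number. -/
def realMinorSum (k : ℕ) (H : Matrix ι ι ℍ[ℝ]) : ℝ :=
  ∑ β ∈ Finset.univ.powersetCard k, reDet (padOne β H)

theorem minorSum_eq_realMinorSum {H : Matrix ι ι ℍ[ℝ]} (hH : H.IsHermitian) (k : ℕ) :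
    minorSum k H = realMinorSum k H := by
  rw [minorSum, realMinorSum, ← Quaternion.algebraMap_def, map_sum,
    Finset.sum_subtype _ (p := fun β : Finset ι => β.card = k) (by simp)]
  refine Finset.sum_congr rfl fun β _ => ?_
  rw [hdet_eq_reDet (isHermitian_principal hH _), reDet_principal]
  rfl

theorem realMinorSum_zero (H : Matrix ι ι ℍ[ℝ]) : realMinorSum 0 H = 1 := by
  rw [realMinorSum, Finset.powersetCard_zero, Finset.sum_singleton, ← reDet_principal, reDet]
  rw [Finset.univ_unique, Finset.sum_singleton]
  have : cycleMins (default : Equiv.Perm (∅ : Finset ι)) = ∅ := Finset.eq_empty_of_isEmpty _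
  rw [this]
  simp [Subsingleton.elim (default : Equiv.Perm (∅ : Finset ι)) 1]

theorem realMinorSum_of_lt {k : ℕ} (hk : Fintype.card ι < k) (H : Matrix ι ι ℍ[ℝ]) :
    realMinorSum k H = 0 := by
  rw [realMinorSum, Finset.powersetCard_eq_empty.2 (by simpa using hk), Finset.sum_empty]

/-- The matrix of the linear maps `c ↦ cdetSum k H i c`. -/
def adjugateSum (k : ℕ) (H : Matrix ι ι ℍ[ℝ]) : Matrix ι ι ℍ[ℝ] :=
  Matrix.of fun i t => cdetSum k H i (Pi.single t 1)

theorem adjugateSum_apply (k : ℕ) (H : Matrix ι ι ℍ[ℝ]) (i t : ι) :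
    adjugateSum k H i t = cdetSum k H i (Pi.single t 1) := rfl

theorem cdetSum_eq_mulVec {H : Matrix ι ι ℍ[ℝ]} (hH : H.IsHermitian) (k : ℕ) (i : ι)
    (c : ι → ℍ[ℝ]) : cdetSum k H i c = ∑ t, adjugateSum k H i t * c t := by
  simp only [adjugateSum_apply, cdetSum_eq_sum_powersetCard hH, Finset.sum_mul]
  rw [Finset.sum_comm]
  refine Finset.sum_congr rfl fun β hβ => ?_
  have hi : i ∈ β := (Finset.mem_filter.1 hβ).2
  simp only [padOne_updateCol H _ hi]
  rw [cycleDet_updateCol_eq_sum]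
  refine Finset.sum_congr rfl fun t _ => ?_
  by_cases ht : t ∈ β
  · rw [if_pos ht]
    congr 3
    funext a
    by_cases ha : a ∈ β
    · rw [if_pos ha]
    · rw [if_neg ha, Pi.single_eq_of_ne]
      exact fun hc => ha (hc ▸ ht)
  · have : (fun a => if a ∈ β then (Pi.single t 1 : ι → ℍ[ℝ]) a else 0) = 0 := by
      funext a
      by_cases ha : a ∈ β
      · rw [if_pos ha, Pi.single_eq_of_ne, Pi.zero_apply]
        exact fun hc => ht (hc ▸ ha)
      · rw [if_neg ha, Pi.zero_apply]
    rw [this, cycleDet_updateCol_zero, if_neg ht, mul_zero, zero_mul]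

theorem sum_powersetCard_succ {R : Type*} [AddCommMonoid R] (k : ℕ) (i : ι)
    (p : Finset ι → Prop) [DecidablePred p] (f : Finset ι → R)
    (hp : ∀ β, i ∉ β → (p (insert i β) ↔ p β)) :
    ∑ β ∈ (Finset.univ.powersetCard (k + 1)).filter (fun β => i ∈ β ∧ p β), f β =
      ∑ β ∈ (Finset.univ.powersetCard k).filter (fun β => i ∉ β ∧ p β), f (insert i β) := by
  refine Finset.sum_nbij' (fun β => β.erase i) (fun β => insert i β) ?_ ?_ ?_ ?_ ?_
  · intro β hβ
    simp only [Finset.mem_filter, Finset.mem_powersetCard, Finset.subset_univ, true_and] at hβ ⊢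
    refine ⟨by rw [Finset.card_erase_of_mem hβ.2.1, hβ.1, Nat.add_sub_cancel],
      Finset.notMem_erase _ _, ?_⟩
    rw [← hp _ (Finset.notMem_erase _ _), Finset.insert_erase hβ.2.1]
    exact hβ.2.2
  · intro β hβ
    simp only [Finset.mem_filter, Finset.mem_powersetCard, Finset.subset_univ, true_and] at hβ ⊢
    exact ⟨by rw [Finset.card_insert_of_notMem hβ.2.1, hβ.1], Finset.mem_insert_self _ _,
      (hp _ hβ.2.1).2 hβ.2.2⟩
  · intro β hβ
    exact Finset.insert_erase (Finset.mem_filter.1 hβ).2.1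
  · intro β hβ
    exact Finset.erase_insert (Finset.mem_filter.1 hβ).2.1
  · intro β hβ
    rw [Finset.insert_erase (Finset.mem_filter.1 hβ).2.1]

theorem cycleDet_padOne_insert_single (H : Matrix ι ι ℍ[ℝ]) {β : Finset ι} {i : ι} (hi : i ∉ β) :
    cycleDet i (padOne (insert i β) (H.updateCol i (Pi.single i 1))) =
      cycleDet i (padOne β H) := by
  apply cycleDet_congr_of_single
  · intro a
    by_cases ha : a = i
    · simp [padOne_apply, ha]
    · simp [padOne_apply, ha]
  · intro a
    simp [padOne_apply, hi]
  · intro a b ha hb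
    simp [padOne_apply, ha, hb]

/-- Expansion along the unit column `e_j` in place `i`: deleting row `j` leaves column `j` of `H` to
take over place `i`, at the cost of a sign. -/
theorem cycleDet_padOne_insert_single_ne (H : Matrix ι ι ℍ[ℝ]) {β : Finset ι} {i j : ι}
    (hi : i ∈ β) (hj : j ∉ β) :
    cycleDet i (padOne (insert j β) (H.updateCol i (Pi.single j 1))) =
      -cycleDet i (padOne β (H.updateCol i fun a => H a j)) := by
  have hne : i ≠ j := fun hc => hj (hc ▸ hi)
  apply cycleDet_eq_neg_of_single hne
  · intro a
    by_cases ha : a = j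
    · simp [padOne_apply, ha, hi]
    · by_cases hai : a = i
      · simp [padOne_apply, hai, hi, hne]
      · simp [padOne_apply, ha, hai]
  · intro a
    simp [padOne_apply, hj]
  · intro a ha
    by_cases hai : a = i
    · simp [padOne_apply, hai, hi, hne.symm]
    · simp [padOne_apply, hai, hi, hne.symm, ha]
  · intro a b ha hbi hbj
    simp [padOne_apply, ha, hbi, hbj]

theorem adjugateSum_succ_diag {H : Matrix ι ι ℍ[ℝ]} (hH : H.IsHermitian) (k : ℕ) (i : ι) :
    adjugateSum (k + 1) H i i =
      ((∑ β ∈ (Finset.univ.powersetCard k).filter (i ∉ ·), reDet (padOne β H) : ℝ) : ℍ[ℝ]) := by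
  have h := sum_powersetCard_succ k i (fun _ => True)
    (fun β => cycleDet i (padOne β (H.updateCol i (Pi.single i 1)))) (fun _ _ => Iff.rfl)
  simp only [and_true] at h
  rw [adjugateSum_apply, cdetSum_eq_sum_powersetCard hH, h, ← Quaternion.algebraMap_def, map_sum]
  refine Finset.sum_congr rfl fun β hβ => ?_
  rw [cycleDet_padOne_insert_single H (Finset.mem_filter.1 hβ).2,
    cycleDet_eq_reDet (isHermitian_padOne hH β)]
  rfl

/-- Minors containing `i` are all minors minus those avoiding `i`; the latter form the diagonal
entry of the next adjugate. -/
theorem cdetSum_col_self {H : Matrix ι ι ℍ[ℝ]} (hH : H.IsHermitian) (k : ℕ) (i : ι) :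
    cdetSum k H i (fun t => H t i) =
      (realMinorSum k H : ℍ[ℝ]) - adjugateSum (k + 1) H i i := by
  have e : H.updateCol i (fun t => H t i) = H := Matrix.updateCol_eq_self H i
  rw [cdetSum_eq_sum_powersetCard hH, e, adjugateSum_succ_diag hH, realMinorSum,
    ← Finset.sum_filter_add_sum_filter_not (Finset.univ.powersetCard k) (i ∈ ·)
      fun β => reDet (padOne β H), Quaternion.coe_add, add_sub_cancel_right,
    ← Quaternion.algebraMap_def, map_sum]
  refine Finset.sum_congr rfl fun β _ => ?_
  rw [cycleDet_eq_reDet (isHermitian_padOne hH β)]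
  rfl

/-- Sets `β` containing `j` give two equal columns, hence zero. The others correspond, by inserting
`j`, to the sets on the right where the unit column does not vanish. -/
theorem cdetSum_col_of_ne {H : Matrix ι ι ℍ[ℝ]} (hH : H.IsHermitian) (k : ℕ) {i j : ι}
    (hne : i ≠ j) : cdetSum k H i (fun t => H t j) = -adjugateSum (k + 1) H i j := by
  rw [adjugateSum_apply, cdetSum_eq_sum_powersetCard hH, cdetSum_eq_sum_powersetCard hH]
  have e1 : ∑ β ∈ (Finset.univ.powersetCard k).filter (i ∈ ·),
      cycleDet i (padOne β (H.updateCol i fun t => H t j)) =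
      ∑ β ∈ (Finset.univ.powersetCard k).filter (fun β => j ∉ β ∧ i ∈ β),
        cycleDet i (padOne β (H.updateCol i fun t => H t j)) := by
    symm
    refine Finset.sum_subset (fun β hβ => ?_) fun β hβ hβ' => ?_
    · simp only [Finset.mem_filter] at hβ ⊢
      exact ⟨hβ.1, hβ.2.2⟩
    · simp only [Finset.mem_filter, not_and] at hβ hβ'
      have hj : j ∈ β := by
        by_contra hj
        exact hβ' hβ.1 hj hβ.2
      refine cycleDet_eq_zero_of_col_eq hne (isHermitianOff_padOne_updateCol hH _ hβ.2) fun a => ?_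
      rw [padOne_updateCol H _ hβ.2, Matrix.updateCol_self, Matrix.updateCol_ne hne.symm,
        padOne_apply]
      by_cases ha : a ∈ β
      · simp [ha, hj]
      · have : a ≠ j := fun hc => ha (hc ▸ hj)
        simp [ha, this]
  have e2 : ∑ β ∈ (Finset.univ.powersetCard (k + 1)).filter (i ∈ ·),
      cycleDet i (padOne β (H.updateCol i (Pi.single j 1))) =
      ∑ β ∈ (Finset.univ.powersetCard (k + 1)).filter (fun β => j ∈ β ∧ i ∈ β),
        cycleDet i (padOne β (H.updateCol i (Pi.single j 1))) := by
    symm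
    refine Finset.sum_subset (fun β hβ => ?_) fun β hβ hβ' => ?_
    · simp only [Finset.mem_filter] at hβ ⊢
      exact ⟨hβ.1, hβ.2.2⟩
    · simp only [Finset.mem_filter, not_and] at hβ hβ'
      have hj : j ∉ β := fun hj => hβ' hβ.1 hj hβ.2
      rw [padOne_updateCol H _ hβ.2]
      convert cycleDet_updateCol_zero i _
      rename_i a
      by_cases ha : a ∈ β
      · rw [if_pos ha, Pi.single_eq_of_ne, Pi.zero_apply]
        exact fun hc => hj (hc ▸ ha)
      · rw [if_neg ha, Pi.zero_apply]
  rw [e1, e2, sum_powersetCard_succ k j (fun β => i ∈ β) _ fun β _ => by simp [hne],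
    ← Finset.sum_neg_distrib]
  refine Finset.sum_congr rfl fun β hβ => ?_
  obtain ⟨-, hj, hi⟩ := Finset.mem_filter.1 hβ
  rw [cycleDet_padOne_insert_single_ne H hi hj, neg_neg]

/-- The recursion of Faddeev and LeVerrier. -/
theorem adjugateSum_mul {H : Matrix ι ι ℍ[ℝ]} (hH : H.IsHermitian) (k : ℕ) :
    adjugateSum k H * H = realMinorSum k H • (1 : Matrix ι ι ℍ[ℝ]) - adjugateSum (k + 1) H := by
  ext1 i j
  rw [Matrix.mul_apply, ← cdetSum_eq_mulVec hH k i fun t => H t j, Matrix.sub_apply,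
    Matrix.smul_apply]
  by_cases hij : i = j
  · subst hij
    rw [cdetSum_col_self hH, Matrix.one_apply_eq, ← Quaternion.coe_mul_eq_smul, mul_one]
  · rw [cdetSum_col_of_ne hH k hij, Matrix.one_apply_ne hij, smul_zero, zero_sub]

theorem adjugateSum_zero {H : Matrix ι ι ℍ[ℝ]} (hH : H.IsHermitian) : adjugateSum 0 H = 0 := by
  ext1 i j
  rw [adjugateSum_apply, cdetSum_eq_sum_powersetCard hH]
  refine Finset.sum_eq_zero fun β hβ => ?_
  simp only [Finset.powersetCard_zero, Finset.mem_filter, Finset.mem_singleton] at hβ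
  simp [hβ.1] at hβ

theorem adjugateSum_of_lt {H : Matrix ι ι ℍ[ℝ]} (hH : H.IsHermitian) {k : ℕ}
    (hk : Fintype.card ι < k) : adjugateSum k H = 0 := by
  ext1 i j
  rw [adjugateSum_apply, cdetSum_eq_sum_powersetCard hH,
    Finset.powersetCard_eq_empty.2 (by simpa using hk), Finset.filter_empty, Finset.sum_empty]
  rfl

/-- Each minor of order `k` occurs in the diagonal entries of exactly those indices outside `β`. -/
theorem re_trace_adjugateSum {H : Matrix ι ι ℍ[ℝ]} (hH : H.IsHermitian) (k : ℕ) :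
    (adjugateSum (k + 1) H).trace.re = ((Fintype.card ι : ℝ) - k) * realMinorSum k H := by
  have h : (adjugateSum (k + 1) H).trace =
      ((((Fintype.card ι : ℝ) - k) * realMinorSum k H : ℝ) : ℍ[ℝ]) := by
    simp only [Matrix.trace, Matrix.diag, adjugateSum_succ_diag hH]
    rw [← Quaternion.algebraMap_def, ← map_sum]
    congr 1
    simp only [Finset.sum_filter]
    rw [Finset.sum_comm, realMinorSum, Finset.mul_sum]
    refine Finset.sum_congr rfl fun β hβ => ?_
    rw [← Finset.sum_filter, Finset.sum_const, nsmul_eq_mul]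
    congr 1
    have h1 := Finset.card_compl_add_card β
    rw [(Finset.mem_powersetCard.1 hβ).2] at h1
    rw [eq_sub_iff_add_eq, ← h1, Nat.cast_add]
    congr 3
    ext a
    simp
  rw [h, Quaternion.re_coe]

end Adjugate

/-! ### Row spaces, positivity of `M * Mᴴ`, and traces of idempotents. -/

section RowSpace

variable {l m n : Type*} [Fintype l] [Fintype m] [Fintype n]

theorem mem_rowSpace {M : Matrix m n ℍ[ℝ]} {v : n → ℍ[ℝ]} :
    v ∈ rowSpace M ↔ ∃ x, x ᵥ* M = v := by
  simp [rowSpace]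

theorem rowSpace_mul_le (M : Matrix l m ℍ[ℝ]) (N : Matrix m n ℍ[ℝ]) :
    rowSpace (M * N) ≤ rowSpace N := by
  intro v hv
  obtain ⟨x, rfl⟩ := mem_rowSpace.1 hv
  exact mem_rowSpace.2 ⟨x ᵥ* M, Matrix.vecMul_vecMul _ _ _⟩

theorem row_mem_rowSpace (M : Matrix m n ℍ[ℝ]) (i : m) : M i ∈ rowSpace M := by
  classical
  refine mem_rowSpace.2 ⟨Pi.single i 1, ?_⟩
  simp
  rfl

theorem exists_mul_eq_of_rowSpace_le {M : Matrix l n ℍ[ℝ]} {N : Matrix m n ℍ[ℝ]}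
    (h : rowSpace M ≤ rowSpace N) : ∃ Z : Matrix l m ℍ[ℝ], M = Z * N := by
  choose Z hZ using fun i => mem_rowSpace.1 (h (row_mem_rowSpace M i))
  refine ⟨Matrix.of Z, ?_⟩
  ext1 i j
  rw [← hZ i]
  rfl

theorem eq_zero_of_mul_conjTranspose_self {M : Matrix m n ℍ[ℝ]} (h : M * Mᴴ = 0) : M = 0 := by
  ext1 i j
  have h1 : ((∑ t, normSq (M i t) : ℝ) : ℍ[ℝ]) = 0 := by
    have := congrFun (congrFun h i) i
    rw [Matrix.mul_apply] at this
    rw [← Quaternion.algebraMap_def, map_sum]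
    simpa [Quaternion.self_mul_star] using this
  have h2 : ∑ t, normSq (M i t) = 0 := by
    rwa [← Quaternion.coe_zero, Quaternion.coe_inj] at h1
  exact normSq_eq_zero.1 ((Finset.sum_eq_zero_iff_of_nonneg fun _ _ => normSq_nonneg).1 h2 j
    (Finset.mem_univ j))

theorem eq_zero_of_conjTranspose_mul_self {M : Matrix m n ℍ[ℝ]} (h : Mᴴ * M = 0) : M = 0 := by
  have h' : Mᴴ = 0 := eq_zero_of_mul_conjTranspose_self (by
    rwa [Matrix.conjTranspose_conjTranspose])
  rw [← Matrix.conjTranspose_conjTranspose M, h', Matrix.conjTranspose_zero]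

theorem re_sum {κ : Type*} (s : Finset κ) (f : κ → ℍ[ℝ]) :
    (∑ i ∈ s, f i).re = ∑ i ∈ s, (f i).re := by
  classical
  induction s using Finset.induction_on with
  | empty => simp
  | insert a s ha ih => rw [Finset.sum_insert ha, Finset.sum_insert ha, Quaternion.re_add, ih]

theorem conjTranspose_real_smul (r : ℝ) (M : Matrix m n ℍ[ℝ]) : (r • M)ᴴ = r • Mᴴ := by
  ext1 i j
  exact Quaternion.star_smul r (M j i)

theorem re_trace_mul_comm (C : Matrix m n ℍ[ℝ]) (D : Matrix n m ℍ[ℝ]) :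
    (C * D).trace.re = (D * C).trace.re := by
  simp only [Matrix.trace, Matrix.diag, Matrix.mul_apply, re_sum]
  rw [Finset.sum_comm]
  exact Finset.sum_congr rfl fun _ _ => Finset.sum_congr rfl fun _ _ => re_mul_comm _ _

/-- The real trace of an idempotent quaternion matrix is its rank. -/
theorem re_trace_of_idempotent {Q : Matrix m m ℍ[ℝ]} (hQ : Q * Q = Q) :
    Q.trace.re = rk Q := by
  classical
  -- Rank factorization `Q = C * D`, the rows of `D` being a basis of the row space. Idempotence
  -- forces `D * C = 1`, and the real trace is cyclic.
  let b := Module.finBasis ℍ[ℝ] (rowSpace Q)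
  let D : Matrix (Fin (rk Q)) m ℍ[ℝ] := Matrix.of fun a => (b a : m → ℍ[ℝ])
  let C : Matrix m (Fin (rk Q)) ℍ[ℝ] := Matrix.of fun i a => b.repr ⟨Q i, row_mem_rowSpace Q i⟩ a
  have hCD : C * D = Q := by
    ext1 i j
    have h := congrArg (fun v : rowSpace Q => (v : m → ℍ[ℝ]) j)
      (b.sum_repr ⟨Q i, row_mem_rowSpace Q i⟩)
    simp only [Submodule.coe_sum, Submodule.coe_smul, Finset.sum_apply, Pi.smul_apply,
      smul_eq_mul] at h
    rw [Matrix.mul_apply, ← h]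
    rfl
  have hDQ : D * Q = D := by
    ext1 a j
    obtain ⟨x, hx⟩ := mem_rowSpace.1 (b a).2
    have h : (b a : m → ℍ[ℝ]) ᵥ* Q = b a := by
      rw [← hx, Matrix.vecMul_vecMul, hQ]
    exact congrFun h j
  have hDC : D * C = 1 := by
    have h1 : (D * C - 1) * D = 0 := by
      rw [Matrix.sub_mul, Matrix.mul_assoc, hCD, hDQ, Matrix.one_mul, sub_self]
    have hli := Fintype.linearIndependent_iff.1 b.linearIndependent
    rw [← sub_eq_zero]
    ext1 a c
    refine hli ((D * C - 1 : Matrix _ _ ℍ[ℝ]) a) ?_ c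
    ext1
    rw [Submodule.coe_sum]
    funext j
    have h2 := congrFun (congrFun h1 a) j
    rw [Matrix.mul_apply] at h2
    exact (Finset.sum_apply j _ _).trans h2
  rw [← hCD, re_trace_mul_comm, hDC, Matrix.trace_one, Fintype.card_fin,
    Quaternion.re_natCast, hCD]

end RowSpace

/-! ### The last nonzero minor sum has order equal to the rank. -/

section Hermitian

variable {ι : Type*} [Fintype ι] [LinearOrder ι] {H : Matrix ι ι ℍ[ℝ]}

theorem adjugateSum_succ (hH : H.IsHermitian) (k : ℕ) :
    adjugateSum (k + 1) H = realMinorSum k H • (1 : Matrix ι ι ℍ[ℝ]) - adjugateSum k H * H := by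
  rw [adjugateSum_mul hH, sub_sub_cancel]

theorem adjugateSum_mul_comm (hH : H.IsHermitian) (k : ℕ) :
    adjugateSum k H * H = H * adjugateSum k H := by
  induction k with
  | zero => simp [adjugateSum_zero hH]
  | succ k ih =>
    rw [adjugateSum_succ hH, sub_mul, mul_sub, ← Matrix.mul_assoc H, ← ih]
    simp

theorem isHermitian_adjugateSum (hH : H.IsHermitian) (k : ℕ) : (adjugateSum k H).IsHermitian := by
  induction k with
  | zero => simp [adjugateSum_zero hH]
  | succ k ih =>
    rw [Matrix.IsHermitian, adjugateSum_succ hH, Matrix.conjTranspose_sub,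
      conjTranspose_real_smul, Matrix.conjTranspose_one, Matrix.conjTranspose_mul, hH.eq, ih.eq,
      adjugateSum_mul_comm hH]

/-- A Hermitian matrix has no nilpotent part: if `Y = X * H^(n+1)`, then `Y * Yᴴ` contains the
higher power `H^(n+2)` and vanishes with it. -/
theorem mul_eq_zero_of_mul_pow_eq_zero (hH : H.IsHermitian) {X : Matrix ι ι ℍ[ℝ]} (n : ℕ)
    (h : X * H ^ (n + 1) = 0) : X * H = 0 := by
  induction n with
  | zero => simpa using h
  | succ n ih =>
    apply ih
    apply eq_zero_of_mul_conjTranspose_self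
    rw [Matrix.conjTranspose_mul, Matrix.conjTranspose_pow, hH.eq]
    calc X * H ^ (n + 1) * (H ^ (n + 1) * Xᴴ) = X * (H ^ (n + 1) * H ^ (n + 1)) * Xᴴ := by
          simp only [Matrix.mul_assoc]
      _ = X * (H ^ (n + 1 + 1) * H ^ n) * Xᴴ := by
          rw [← pow_add, ← pow_add]; congr 3; ring
      _ = 0 := by rw [← Matrix.mul_assoc X, h]; simp

theorem rk_eq_of_mul_eq {m n : Type*} [Fintype m] [Fintype n] {p : Type*} [Fintype p]
    {M : Matrix m p ℍ[ℝ]} {N : Matrix n p ℍ[ℝ]} (Y : Matrix m n ℍ[ℝ]) (Z : Matrix n m ℍ[ℝ])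
    (hM : M = Y * N) (hN : N = Z * M) : rk M = rk N := by
  have : rowSpace M = rowSpace N := le_antisymm
    (by rw [hM]; exact rowSpace_mul_le _ _) (by rw [hN]; exact rowSpace_mul_le _ _)
  rw [rk, rk, this]

theorem realMinorSum_rk_ne_zero_and (hH : H.IsHermitian) :
    realMinorSum (rk H) H ≠ 0 ∧ adjugateSum (rk H + 1) H * H = 0 := by
  classical
  obtain ⟨K, hK, hmax⟩ : ∃ K, realMinorSum K H ≠ 0 ∧ ∀ k, K < k → realMinorSum k H = 0 := by
    refine ⟨Nat.findGreatest (fun k => realMinorSum k H ≠ 0) (Fintype.card ι),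
      Nat.findGreatest_spec (P := fun k => realMinorSum k H ≠ 0) (Nat.zero_le _)
        (by simp [realMinorSum_zero]), fun k hk => ?_⟩
    by_cases hc : k ≤ Fintype.card ι
    · simpa using Nat.findGreatest_is_greatest hk hc
    · exact realMinorSum_of_lt (not_le.1 hc) H
  -- Past `K` the scalar term of the recursion is gone. As adjugates of order beyond the size
  -- vanish, a power of `H` kills `R_(K+1)`, and therefore `H` itself does.
  have hpow : ∀ n, adjugateSum (K + 1 + n) H = (-1) ^ n * (adjugateSum (K + 1) H * H ^ n) := by
    intro n
    induction n with
    | zero => simp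
    | succ n ih =>
      rw [← add_assoc, adjugateSum_succ hH, hmax _ (by omega), zero_smul, zero_sub, ih, pow_succ,
        pow_succ]
      simp [mul_assoc]
  have hzero : adjugateSum (K + 1) H * H = 0 := by
    apply mul_eq_zero_of_mul_pow_eq_zero hH (Fintype.card ι)
    have h := hpow (Fintype.card ι + 1)
    rw [adjugateSum_of_lt hH (by omega)] at h
    have h' : ∀ (N : ℕ) (X : Matrix ι ι ℍ[ℝ]), X = (-1) ^ N * ((-1) ^ N * X) := fun N X => by
      rw [← mul_assoc, ← pow_add, Even.neg_one_pow ⟨N, rfl⟩, one_mul]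
    rw [h' (Fintype.card ι + 1) (_ * _), ← h, mul_zero]
  have hRH : adjugateSum K H * H = realMinorSum K H • 1 - adjugateSum (K + 1) H :=
    adjugateSum_mul hH K
  set G := (realMinorSum K H)⁻¹ • adjugateSum K H with hG
  set P := (realMinorSum K H)⁻¹ • adjugateSum (K + 1) H with hP
  have hGH : G * H = 1 - P := by
    rw [hG, hP, Matrix.smul_mul, hRH, smul_sub, smul_smul, inv_mul_cancel₀ hK, one_smul]
  have hPH : P * H = 0 := by rw [hP, Matrix.smul_mul, hzero, smul_zero]
  have hHP : H * P = 0 := by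
    rw [hP, Matrix.mul_smul, ← adjugateSum_mul_comm hH, hzero, smul_zero]
  have hHGH : H * (G * H) = H := by rw [hGH, mul_sub, hHP, mul_one, sub_zero]
  have hcomm : G * H = H * G := by
    rw [hG, Matrix.smul_mul, Matrix.mul_smul, adjugateSum_mul_comm hH]
  have hidem : (G * H) * (G * H) = G * H := by
    rw [Matrix.mul_assoc, hHGH]
  -- The idempotent `G * H = 1 - P` has the rank of `H`, and with `N` the size its trace is `N - (N
  -- - K) = K`.
  have htr := re_trace_of_idempotent hidem
  rw [rk_eq_of_mul_eq G H rfl hHGH.symm, hGH, Matrix.trace_sub, Matrix.trace_one,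
    Quaternion.re_sub, Quaternion.re_natCast, hP, Matrix.trace_smul, Quaternion.re_smul,
    re_trace_adjugateSum hH, smul_eq_mul, mul_comm, mul_assoc, mul_inv_cancel₀ hK, mul_one,
    sub_sub_cancel, Nat.cast_inj] at htr
  rw [← htr]
  exact ⟨hK, hzero⟩

end Hermitian

/-! ### The Moore–Penrose inverse through the Gram matrix. -/

section MoorePenrose

variable {ι κ : Type*} [Fintype ι] [LinearOrder ι] [Fintype κ]

/-- By the recursion the error term is `B * R_(s+1)`; it is killed by `Bᴴ`, hence zero. -/
theorem mul_adjugateSum_mul_gram (B : Matrix κ ι ℍ[ℝ]) :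
    B * ((realMinorSum (rk (Bᴴ * B)) (Bᴴ * B))⁻¹ • adjugateSum (rk (Bᴴ * B)) (Bᴴ * B)) *
      (Bᴴ * B) = B := by
  have hH : (Bᴴ * B).IsHermitian := Matrix.isHermitian_conjTranspose_mul_self B
  obtain ⟨h0, h1⟩ := realMinorSum_rk_ne_zero_and hH
  have hc := adjugateSum_mul_comm hH (rk (Bᴴ * B) + 1)
  have h2 := adjugateSum_mul hH (rk (Bᴴ * B))
  set s := rk (Bᴴ * B)
  have h3 : Bᴴ * (B * adjugateSum (s + 1) (Bᴴ * B)) = 0 := by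
    rw [← Matrix.mul_assoc, ← hc, h1]
  have h4 : B * adjugateSum (s + 1) (Bᴴ * B) = 0 := by
    apply eq_zero_of_conjTranspose_mul_self
    rw [Matrix.conjTranspose_mul, Matrix.mul_assoc, h3, Matrix.mul_zero]
  rw [Matrix.mul_assoc, Matrix.smul_mul, h2, Matrix.mul_smul, Matrix.mul_sub, h4, sub_zero,
    Matrix.mul_smul, Matrix.mul_one, smul_smul, inv_mul_cancel₀ h0, one_smul]

theorem rk_conjTranspose_mul_self (B : Matrix κ ι ℍ[ℝ]) : rk (Bᴴ * B) = rk B :=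
  rk_eq_of_mul_eq Bᴴ _ rfl (mul_adjugateSum_mul_gram B).symm

theorem realMinorSum_gram_ne_zero (B : Matrix κ ι ℍ[ℝ]) :
    realMinorSum (rk B) (Bᴴ * B) ≠ 0 := by
  rw [← rk_conjTranspose_mul_self]
  exact (realMinorSum_rk_ne_zero_and (Matrix.isHermitian_conjTranspose_mul_self B)).1

/-- The determinantal representation of the Moore-Penrose inverse. -/
def penroseInverse (B : Matrix κ ι ℍ[ℝ]) : Matrix ι κ ℍ[ℝ] :=
  (realMinorSum (rk B) (Bᴴ * B))⁻¹ • (adjugateSum (rk B) (Bᴴ * B) * Bᴴ)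

theorem isMoorePenrose_penroseInverse (B : Matrix κ ι ℍ[ℝ]) :
    IsMoorePenrose B (penroseInverse B) := by
  have hH : (Bᴴ * B).IsHermitian := Matrix.isHermitian_conjTranspose_mul_self B
  have h1 := mul_adjugateSum_mul_gram B
  rw [rk_conjTranspose_mul_self] at h1
  have hY : penroseInverse B =
      ((realMinorSum (rk B) (Bᴴ * B))⁻¹ • adjugateSum (rk B) (Bᴴ * B)) * Bᴴ := by
    rw [penroseInverse, Matrix.smul_mul]
  have hG : ((realMinorSum (rk B) (Bᴴ * B))⁻¹ • adjugateSum (rk B) (Bᴴ * B)).IsHermitian := by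
    rw [Matrix.IsHermitian, conjTranspose_real_smul, (isHermitian_adjugateSum hH _).eq]
  have hcomm : ((realMinorSum (rk B) (Bᴴ * B))⁻¹ • adjugateSum (rk B) (Bᴴ * B)) * (Bᴴ * B) =
      (Bᴴ * B) * ((realMinorSum (rk B) (Bᴴ * B))⁻¹ • adjugateSum (rk B) (Bᴴ * B)) := by
    rw [Matrix.smul_mul, Matrix.mul_smul, adjugateSum_mul_comm hH]
  rw [hY]
  set G := (realMinorSum (rk B) (Bᴴ * B))⁻¹ • adjugateSum (rk B) (Bᴴ * B)
  have h2 := congrArg Matrix.conjTranspose h1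
  rw [Matrix.conjTranspose_mul, Matrix.conjTranspose_mul B G, hH.eq, hG.eq] at h2
  refine ⟨?_, ?_, ?_, ?_⟩
  · rw [Matrix.mul_assoc] at h1
    simpa only [Matrix.mul_assoc] using h1
  · calc G * Bᴴ * B * (G * Bᴴ) = G * (Bᴴ * B * (G * Bᴴ)) := by simp only [Matrix.mul_assoc]
      _ = G * Bᴴ := by rw [h2]
  · rw [Matrix.conjTranspose_mul, Matrix.conjTranspose_mul, hG.eq,
      Matrix.conjTranspose_conjTranspose, Matrix.mul_assoc]
  · rw [Matrix.mul_assoc, Matrix.conjTranspose_mul, hH.eq, hG.eq, hcomm]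

end MoorePenrose

/-! ### The index and stabilization of row spaces of powers. -/

section Index

variable {n : Type*} [Fintype n] [DecidableEq n]

theorem rk_pow_succ_le (M : Matrix n n ℍ[ℝ]) (k : ℕ) : rk (M ^ (k + 1)) ≤ rk (M ^ k) := by
  rw [pow_succ']
  exact Submodule.finrank_mono (rowSpace_mul_le _ _)

theorem rk_pow_ind (M : Matrix n n ℍ[ℝ]) : rk (M ^ (ind M + 1)) = rk (M ^ ind M) := by
  have hne : {k : ℕ | 0 < k ∧ rk (M ^ (k + 1)) = rk (M ^ k)}.Nonempty := by
    -- A positive power of minimal rank shows that the set defining the index is nonempty, so its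
    -- infimum is attained.
    obtain ⟨k, hk⟩ := Nat.sInf_mem (Set.range_nonempty fun k => rk (M ^ (k + 1)))
    refine ⟨k + 1, Nat.succ_pos k, le_antisymm (rk_pow_succ_le M _) ?_⟩
    have h : rk (M ^ (k + 1)) = _ := hk
    rw [h]
    exact Nat.sInf_le ⟨k + 1, rfl⟩
  exact (Nat.sInf_mem hne).2

theorem exists_pow_eq_mul_pow_succ (M : Matrix n n ℍ[ℝ]) {k : ℕ} (hk : ind M ≤ k) :
    ∃ Z, M ^ k = Z * M ^ (k + 1) := by
  have hle : rowSpace (M ^ (ind M + 1)) ≤ rowSpace (M ^ ind M) := by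
    rw [pow_succ']
    exact rowSpace_mul_le _ _
  have he := Submodule.eq_of_le_of_finrank_eq hle (rk_pow_ind M)
  obtain ⟨Z, hZ⟩ := exists_mul_eq_of_rowSpace_le he.ge
  obtain ⟨d, rfl⟩ := Nat.exists_eq_add_of_le hk
  refine ⟨Z, ?_⟩
  rw [show ind M + d + 1 = (ind M + 1) + d by ring, pow_add, pow_add M (ind M + 1), ← mul_assoc,
    ← hZ]

/-- Right multiplication by `M` maps the stabilized row space onto itself, hence injectively by
finite dimension. -/
theorem eq_zero_of_mul_eq_zero_of_rowSpace_le {m : Type*} [Fintype m] {M : Matrix n n ℍ[ℝ]}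
    {k : ℕ} (hk : ind M ≤ k) {D : Matrix m n ℍ[ℝ]} (hD : rowSpace D ≤ rowSpace (M ^ k))
    (h : D * M = 0) : D = 0 := by
  obtain ⟨Z, hZ⟩ := exists_pow_eq_mul_pow_succ M hk
  have hmaps : ∀ v ∈ rowSpace (M ^ k), M.vecMulLinear v ∈ rowSpace (M ^ k) := by
    intro v hv
    obtain ⟨x, rfl⟩ := mem_rowSpace.1 hv
    refine mem_rowSpace.2 ⟨x ᵥ* M, ?_⟩
    rw [Matrix.vecMulLinear_apply, Matrix.vecMul_vecMul, Matrix.vecMul_vecMul, ← pow_succ,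
      ← pow_succ']
  have hsurj : Function.Surjective (M.vecMulLinear.restrict hmaps) := by
    rintro ⟨v, hv⟩
    obtain ⟨x, rfl⟩ := mem_rowSpace.1 hv
    refine ⟨⟨(x ᵥ* Z) ᵥ* M ^ k, mem_rowSpace.2 ⟨_, rfl⟩⟩, Subtype.ext ?_⟩
    change ((x ᵥ* Z) ᵥ* M ^ k) ᵥ* M = x ᵥ* M ^ k
    rw [Matrix.vecMul_vecMul, Matrix.vecMul_vecMul, ← pow_succ, ← hZ]
  have hinj := LinearMap.injective_iff_surjective.2 hsurj
  ext1 i j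
  have hi : (⟨D i, hD (row_mem_rowSpace D i)⟩ : rowSpace (M ^ k)) = 0 := by
    apply hinj
    rw [map_zero]
    refine Subtype.ext ?_
    exact congrFun h i
  exact congrFun (congrArg Subtype.val hi) j

end Index

/-! ### Uniqueness and closed form of the weighted core-EP inverse. -/

section CoreEP

/-- `Y * B` is the Hermitian projector attached to the row space of `B`, and `B`, `C` have the same
row space. With `B = C` this gives independence of the chosen inverse. -/
theorem IsMoorePenrose.mul_eq_mul {l m n : Type*} [Fintype l] [Fintype m] [Fintype n]
    {B : Matrix l n ℍ[ℝ]} {C : Matrix m n ℍ[ℝ]} {Y : Matrix n l ℍ[ℝ]} {Y' : Matrix n m ℍ[ℝ]}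
    (hB : IsMoorePenrose B Y) (hC : IsMoorePenrose C Y') {Z : Matrix l m ℍ[ℝ]}
    {Z' : Matrix m l ℍ[ℝ]} (h : B = Z * C) (h' : C = Z' * B) : Y * B = Y' * C := by
  have e1 : B * (Y' * C) = B := by
    rw [h, Matrix.mul_assoc, ← Matrix.mul_assoc C, hC.mul_mul_left]
  have e2 : C * (Y * B) = C := by
    rw [h', Matrix.mul_assoc, ← Matrix.mul_assoc B, hB.mul_mul_left]
  have e3 : (Y * B) * (Y' * C) = Y * B := by rw [Matrix.mul_assoc, e1]
  have e4 : (Y' * C) * (Y * B) = Y' * C := by rw [Matrix.mul_assoc, e2]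
  rw [← e4, ← hB.right_isHermitian, ← hC.right_isHermitian, ← Matrix.conjTranspose_mul, e3,
    hB.right_isHermitian]

theorem mul_pow_mul_comm {m n : Type*} [Fintype m] [Fintype n] [DecidableEq m] [DecidableEq n]
    (A : Matrix m n ℍ[ℝ]) (W : Matrix n m ℍ[ℝ]) (k : ℕ) : (A * W) ^ k * A = A * (W * A) ^ k := by
  induction k with
  | zero => simp
  | succ k ih =>
    rw [pow_succ, pow_succ, Matrix.mul_assoc, Matrix.mul_assoc A W A, ← Matrix.mul_assoc, ih,
      Matrix.mul_assoc]

variable {m n : ℕ} {A : Matrix (Fin m) (Fin n) ℍ[ℝ]} {W : Matrix (Fin n) (Fin m) ℍ[ℝ]}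

theorem IsLeftWeightedCoreEP.unique {X X' : Matrix (Fin m) (Fin n) ℍ[ℝ]}
    (hX : IsLeftWeightedCoreEP A W X) (hX' : IsLeftWeightedCoreEP A W X') : X = X' := by
  obtain ⟨⟨Y, hY, h⟩, hr⟩ := hX
  obtain ⟨⟨Y', hY', h'⟩, hr'⟩ := hX'
  have hk : ind (W * A) ≤ max (ind (W * A)) (ind (A * W)) := le_max_left _ _
  set k := max (ind (W * A)) (ind (A * W))
  obtain ⟨Z, hZ⟩ := exists_mul_eq_of_rowSpace_le hr
  obtain ⟨Z', hZ'⟩ := exists_mul_eq_of_rowSpace_le hr'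
  have e : X * W * A * W = X' * W * A * W := by
    rw [h, h', hY.mul_eq_mul hY' (Matrix.one_mul _).symm (Matrix.one_mul _).symm]
  have hD : X - X' = (Z - Z') * (W * A) ^ k := by rw [Matrix.sub_mul, ← hZ, ← hZ']
  -- Multiplying the defining equation by `A` turns it into two factors `W * A`, which are then
  -- cancelled one after the other.
  have hD2 : (X - X') * (W * A) * (W * A) = 0 := by
    rw [Matrix.sub_mul, Matrix.sub_mul, sub_eq_zero]
    have := congrArg (· * A) e
    simpa only [Matrix.mul_assoc] using this
  refine sub_eq_zero.1 (eq_zero_of_mul_eq_zero_of_rowSpace_le hk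
    (by rw [hD]; exact rowSpace_mul_le _ _) (eq_zero_of_mul_eq_zero_of_rowSpace_le hk ?_ hD2))
  rw [hD, Matrix.mul_assoc, ← pow_succ, pow_succ', ← Matrix.mul_assoc]
  exact rowSpace_mul_le _ _

theorem isLeftWeightedCoreEP_penroseInverse (A : Matrix (Fin m) (Fin n) ℍ[ℝ])
    (W : Matrix (Fin n) (Fin m) ℍ[ℝ]) {k : ℕ} (hk : k = max (ind (W * A)) (ind (A * W))) :
    IsLeftWeightedCoreEP A W (penroseInverse ((A * W) ^ (k + 1)) * (A * W) ^ k *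
      (penroseInverse ((A * W) ^ (k + 1)) * (A * W) ^ k * A)) := by
  have hk' : ind (A * W) ≤ k := hk ▸ le_max_right _ _
  obtain ⟨Z, hZ⟩ := exists_pow_eq_mul_pow_succ _ hk'
  rw [IsLeftWeightedCoreEP, ← hk]
  have hB := isMoorePenrose_penroseInverse ((A * W) ^ (k + 1))
  set Y := penroseInverse ((A * W) ^ (k + 1))
  -- Since `V^k = Z * V^(k+1)`, this is the first Penrose equation multiplied by `Z`.
  have e1 : (A * W) ^ k * Y * (A * W) ^ (k + 1) = (A * W) ^ k := by
    conv_lhs => rw [hZ]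
    rw [Matrix.mul_assoc, Matrix.mul_assoc, ← Matrix.mul_assoc _ Y, hB.mul_mul_left, ← hZ]
  constructor
  · refine ⟨_, isMoorePenrose_penroseInverse ((A * W) ^ k), ?_⟩
    rw [← hB.mul_eq_mul (isMoorePenrose_penroseInverse _) (pow_succ' _ _) hZ]
    calc Y * (A * W) ^ k * (Y * (A * W) ^ k * A) * W * A * W
        = Y * ((A * W) ^ k * Y * ((A * W) ^ k * (A * W))) * (A * W) := by
          simp only [Matrix.mul_assoc]
      _ = Y * (A * W) ^ (k + 1) := by
          rw [← pow_succ, e1, Matrix.mul_assoc, ← pow_succ]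
  · rw [Matrix.mul_assoc _ _ A, mul_pow_mul_comm, ← Matrix.mul_assoc, ← Matrix.mul_assoc]
    exact rowSpace_mul_le _ _

theorem cdetSum_eq_mul {ι κ : Type*} [Fintype ι] [LinearOrder ι] {H : Matrix ι ι ℍ[ℝ]}
    (hH : H.IsHermitian) (s : ℕ) (C : Matrix ι κ ℍ[ℝ]) (i : ι) (j : κ) :
    cdetSum s H i (fun t => C t j) = (adjugateSum s H * C) i j := by
  rw [cdetSum_eq_mulVec hH, Matrix.mul_apply]

end CoreEP

end QuatCoreEP
end

theorem theorem3p6 {m n : ℕ}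
    (A : Matrix (Fin m) (Fin n) ℍ[ℝ]) (W : Matrix (Fin n) (Fin m) ℍ[ℝ])
    (k s : ℕ)
    (hk : k = max (QuatCoreEP.ind (W * A)) (QuatCoreEP.ind (A * W)))
    (hs : s = QuatCoreEP.rk ((A * W) ^ k))
    (V : Matrix (Fin m) (Fin m) ℍ[ℝ]) (hV : V = A * W)
    (Ψ : Matrix (Fin m) (Fin n) ℍ[ℝ])
    (hΨ : ∀ l j, Ψ l j =
      QuatCoreEP.cdetSum s ((V ^ (k + 1))ᴴ * V ^ (k + 1)) l
        (fun t => ((V ^ (k + 1))ᴴ * V ^ k * A) t j)) :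
    (∃! X, QuatCoreEP.IsLeftWeightedCoreEP A W X) ∧
    QuatCoreEP.minorSum s ((V ^ (k + 1))ᴴ * V ^ (k + 1)) ≠ 0 ∧
    ∀ X, QuatCoreEP.IsLeftWeightedCoreEP A W X → ∀ i j,
      X i j =
        QuatCoreEP.cdetSum s ((V ^ (k + 1))ᴴ * V ^ (k + 1)) i
            (fun t => ((V ^ (k + 1))ᴴ * V ^ k * Ψ) t j) /
          (QuatCoreEP.minorSum s ((V ^ (k + 1))ᴴ * V ^ (k + 1))) ^ 2 := by
  have hX := QuatCoreEP.isLeftWeightedCoreEP_penroseInverse A W hk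
  rw [← hV] at hX hs
  have hH : ((V ^ (k + 1))ᴴ * V ^ (k + 1)).IsHermitian :=
    Matrix.isHermitian_conjTranspose_mul_self _
  have hrk : QuatCoreEP.rk (V ^ (k + 1)) = s := by
    obtain ⟨Z, hZ⟩ := QuatCoreEP.exists_pow_eq_mul_pow_succ V
      (k := k) (by rw [hV, hk]; exact le_max_right _ _)
    rw [hs]
    exact QuatCoreEP.rk_eq_of_mul_eq V Z (pow_succ' V k) hZ
  have h0 := QuatCoreEP.realMinorSum_gram_ne_zero (V ^ (k + 1))
  rw [hrk] at h0
  rw [QuatCoreEP.minorSum_eq_realMinorSum hH]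
  refine ⟨⟨_, hX, fun X' hX' => hX'.unique hX⟩, ?_, ?_⟩
  · rw [← Quaternion.coe_zero]
    exact Quaternion.coe_injective.ne h0
  · intro X hX' i j
    have hΨ' : Ψ = QuatCoreEP.adjugateSum s ((V ^ (k + 1))ᴴ * V ^ (k + 1)) *
        ((V ^ (k + 1))ᴴ * V ^ k * A) := by
      ext1 l j
      rw [hΨ, QuatCoreEP.cdetSum_eq_mul hH]
    rw [hX'.unique hX, QuatCoreEP.cdetSum_eq_mul hH, hΨ', QuatCoreEP.penroseInverse, hrk]
    set σ := QuatCoreEP.realMinorSum s ((V ^ (k + 1))ᴴ * V ^ (k + 1))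
    set R := QuatCoreEP.adjugateSum s ((V ^ (k + 1))ᴴ * V ^ (k + 1))
    -- The minor sum is real, hence central: both factors `σ⁻¹` can be collected, and the quaternion
    -- division is unambiguous.
    have e : σ⁻¹ • (R * (V ^ (k + 1))ᴴ) * V ^ k * (σ⁻¹ • (R * (V ^ (k + 1))ᴴ) * V ^ k * A) =
        (σ ^ 2)⁻¹ • (R * ((V ^ (k + 1))ᴴ * V ^ k * (R * ((V ^ (k + 1))ᴴ * V ^ k * A)))) := by
      simp only [Matrix.smul_mul, Matrix.mul_smul, smul_smul, Matrix.mul_assoc]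
      congr 1
      ring
    rw [e, Matrix.smul_apply, ← Quaternion.mul_coe_eq_smul, Quaternion.coe_inv,
      Quaternion.coe_pow, div_eq_mul_inv]
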